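/- Let $E$ be an elliptic curve over a finite field $\mathbb{F}_q$, given by a Weierstrass equation with point at infinity $O$, and let $\mathcal{P}$ be a cyclic subgroup of $E(\mathbb{F}_q)$ of order $n\ge 5$. Fix any generator $\mathbf{P}$ of $\mathcal{P}$ and put $\mathbf{P}_i=i\mathbf{P}$ for $0\le i\le n-1$. Let $v_{\mathbf P_i}$ denote the normalized discrete valuation of the function field $\mathbb{F}_q(E)$ at $\mathbf{P}_i$, and let $$L_{\mathcal P}=\{(v_{\mathbf P_0}(f),\dots,v_{\mathbf P_{n-1}}(f)) : f\in \mathbb{F}_q(E)^*,\ \text{the divisor of } f \text{ has support contained in } \mathcal{P}\}\subseteq\mathbb{Z}^n .$$ Then $L_{\mathcal P}$ is the Barnes lattice $$B_{n-1}=\Big\{x\in\mathbb{Z}^n : \sum_{i=0}^{n-1}x_i=0,\ \sum_{i=0}^{n-1} i\,x_i\equiv 0 \pmod n\Big\}.$$ Let $e_0,\dots,e_{n-1}$ be the standard basis of $\mathbb{Z}^n$ and define $$\mathbf v_k=e_0+e_k-e_{k+1}-e_{n-1}\quad(1\le k\le n-3),$$ $$\mathbf v_{n-2}=-e_0+e_1+e_{n-3}-e_{n-2},\qquad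 \mathbf v_{n-1}=-e_0+e_1+e_{n-2}-e_{n-1}.$$ Then $\mathbf v_1,\dots,\mathbf v_{n-1}$ form a $\mathbb{Z}$-basis of $L_{\mathcal P}$, and each $\mathbf v_k$ is a minimal vector of $L_{\mathcal P}$, that is, a nonzero vector of $L_{\mathcal P}$ of least Euclidean norm. -/

import Mathlib

/-- The closed points of the elliptic curve `W` over the field `F`: the point at infinity `none`,
and the maximal ideals of the affine coordinate ring `F[W]` (closed points of arbitrary degree). -/
abbrev ClosedPoint {F : Type*} [Field F] (W : WeierstrassCurve F) :=
  Option (MaximalSpectrum W.toAffine.CoordinateRing)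

/-- The ideal of a rational affine point is maximal, its quotient being `F`. -/
theorem isMaximal_XYIdeal {F : Type*} [Field F] (W : WeierstrassCurve F) {x y : F}
    (h : W.toAffine.Nonsingular x y) :
    (WeierstrassCurve.Affine.CoordinateRing.XYIdeal W.toAffine x (Polynomial.C y)).IsMaximal :=
  Ideal.Quotient.maximal_of_isField _
    ((WeierstrassCurve.Affine.CoordinateRing.quotientXYIdealEquiv
      (W' := W.toAffine) (y := Polynomial.C y)
      (by simpa [WeierstrassCurve.Affine.Equation, Polynomial.evalEval] using
        h.1)).toMulEquiv.isField (Field.toIsField F))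

/-- The closed point defined by a rational point. -/
noncomputable def toClosedPoint {F : Type*} [Field F] (W : WeierstrassCurve F) :
    W.toAffine.Point → ClosedPoint W
  | .zero => none
  | .some x y h => Option.some
      ⟨WeierstrassCurve.Affine.CoordinateRing.XYIdeal W.toAffine x (Polynomial.C y),
        isMaximal_XYIdeal W h⟩

/-- The coordinate function `x` in the function field. -/
noncomputable def xFun {F : Type*} [Field F] (W : WeierstrassCurve F) :
    W.toAffine.FunctionField :=
  algebraMap W.toAffine.CoordinateRing _
    (WeierstrassCurve.Affine.CoordinateRing.mk W.toAffine (Polynomial.C Polynomial.X))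

/-- The coordinate function `y` in the function field. -/
noncomputable def yFun {F : Type*} [Field F] (W : WeierstrassCurve F) :
    W.toAffine.FunctionField :=
  algebraMap W.toAffine.CoordinateRing _
    (WeierstrassCurve.Affine.CoordinateRing.mk W.toAffine Polynomial.X)

/-- `IsRegularAt W c f`: the rational function `f` belongs to the local ring of the curve at the
closed point `c`. At a maximal ideal `m` of `F[W]` this is the localization of `F[W]` at `m`; at
infinity, that is at `[0 : 1 : 0]`, it consists of the quotients of polynomials in the affine
coordinates `x / y`, `1 / y` of the chart `Y ≠ 0` of the projective curve, the denominator not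
vanishing at the origin. -/
def IsRegularAt {F : Type*} [Field F] (W : WeierstrassCurve F) :
    ClosedPoint W → W.toAffine.FunctionField → Prop
  | none, f => ∃ A B : MvPolynomial (Fin 2) F, MvPolynomial.constantCoeff B ≠ 0 ∧
      f = MvPolynomial.aeval ![xFun W / yFun W, 1 / yFun W] A /
        MvPolynomial.aeval ![xFun W / yFun W, 1 / yFun W] B
  | Option.some m, f => ∃ a b : W.toAffine.CoordinateRing, b ∉ m.asIdeal ∧
      f = algebraMap _ W.toAffine.FunctionField a / algebraMap _ W.toAffine.FunctionField b

/-- `f` is a unit of the local ring at `c`, i.e. it has neither a zero nor a pole at `c`. -/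
def IsUnitAt {F : Type*} [Field F] (W : WeierstrassCurve F) (c : ClosedPoint W)
    (f : W.toAffine.FunctionField) : Prop :=
  f ≠ 0 ∧ IsRegularAt W c f ∧ IsRegularAt W c f⁻¹

/-- `t` generates the maximal ideal of the local ring at `c`. -/
def IsUniformizerAt {F : Type*} [Field F] (W : WeierstrassCurve F) (c : ClosedPoint W)
    (t : W.toAffine.FunctionField) : Prop :=
  IsRegularAt W c t ∧ ¬ IsUnitAt W c t ∧
    ∀ g, IsRegularAt W c g → ¬ IsUnitAt W c g → ∃ h, IsRegularAt W c h ∧ g = t * h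

/-- The normalized discrete valuation at `c` takes the value `k` at the nonzero function `f`. -/
def HasOrd {F : Type*} [Field F] (W : WeierstrassCurve F) (c : ClosedPoint W)
    (f : W.toAffine.FunctionField) (k : ℤ) : Prop :=
  ∃ t u, IsUniformizerAt W c t ∧ IsUnitAt W c u ∧ f = t ^ k * u

/-- For a family of rational points `P 0, …, P (n - 1)`, the set of all integer vectors
`(v_0(f), …, v_{n-1}(f))`, where `f` runs through the nonzero rational functions whose divisor is
supported on these points and `v_i` is the normalized valuation at `P i`. -/
def ellipticLattice {F : Type*} [Field F] (W : WeierstrassCurve F) {n : ℕ}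
    (P : Fin n → W.toAffine.Point) : Set (Fin n → ℤ) :=
  {x | ∃ f : W.toAffine.FunctionField, f ≠ 0 ∧
    (∀ c, c ∉ Set.range (fun i => toClosedPoint W (P i)) → IsUnitAt W c f) ∧
    ∀ i, HasOrd W (toClosedPoint W (P i)) f (x i)}

/-- The Barnes lattice `B_{n-1}`, as a set of vectors in `ℤ^n`. -/
def barnesLattice (n : ℕ) : Set (Fin n → ℤ) :=
  {x | ∑ i, x i = 0 ∧ (∑ i : Fin n, (i : ℤ) * x i) ≡ 0 [ZMOD (n : ℤ)]}

/-- The Euclidean norm of an integer vector, viewed in `ℝ^n`. -/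
noncomputable def euclNorm {n : ℕ} (x : Fin n → ℤ) : ℝ :=
  ‖WithLp.toLp 2 (fun i => (x i : ℝ))‖

/-- `x` is a nonzero vector of `L` of least Euclidean norm. -/
def IsMinimalVector {n : ℕ} (L : Set (Fin n → ℤ)) (x : Fin n → ℤ) : Prop :=
  x ∈ L ∧ x ≠ 0 ∧ ∀ y ∈ L, y ≠ 0 → euclNorm x ≤ euclNorm y

/-- The standard basis vector of `ℤ^n` with `1` at coordinate `m`, coordinates being numbered
`0, …, n - 1`. -/
def stdVec (n m : ℕ) : Fin n → ℤ := fun j => if (j : ℕ) = m then 1 else 0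

/-- The vectors `v_k ∈ ℤ^n`, `1 ≤ k ≤ n - 1`:
`v_k = e_0 + e_k - e_{k+1} - e_{n-1}` for `k ≤ n - 3`,
`v_{n-2} = -e_0 + e_1 + e_{n-3} - e_{n-2}`, and `v_{n-1} = -e_0 + e_1 + e_{n-2} - e_{n-1}`. -/
def basisVec (n k : ℕ) : Fin n → ℤ :=
  if k ≤ n - 3 then stdVec n 0 + stdVec n k - stdVec n (k + 1) - stdVec n (n - 1)
  else if k = n - 2 then -stdVec n 0 + stdVec n 1 + stdVec n (n - 3) - stdVec n (n - 2)
  else -stdVec n 0 + stdVec n 1 + stdVec n (n - 2) - stdVec n (n - 1)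

/-! The arithmetic input is Abel's theorem, `mem_ellipticLattice_iff`: for distinct rational points
including `O`, the divisor `∑ x_i (P_i)` is principal iff `∑ x_i = 0` and `∑ x_i P_i = O`. For the
points `iP` with `P` of order `n`, the second condition reads `n ∣ ∑ i x_i`, so the lattice is the
Barnes lattice.

Away from `O`, divisors become invertible fractional ideals of `F[W]`. Such an ideal is determined
by its local generators (`eq_one_of_forall_mem_localGenerators`), and the divisor's ideal is
principal iff `∑ x_i P_i = O`, because the map from points to the class group is an injective
homomorphism. The order at `O` is invisible to ideals. It is recovered from the chord-tangent
relation: the functions realising the group law have explicit orders at `O`, so every principal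
ideal of degree `d` has a generator of order `-d` there (`exists_pointIdeal_mul_pointIdeal`,
`hasOrd_infty_of_mem_degreeGraph`).

The rest is about integers. Vectors of coordinate sum zero have even squared norm; squared norm 2
would force `e_p - e_q` with `p ≡ q` mod `n`, so the minimum is 4, attained by each `v_k`. Modulo
the span of the `v_k`, the classes of the `e_k` form an arithmetic progression whose difference is
killed by `n`, so the whole Barnes lattice vanishes there. Independence is a dimension count over
`ℚ`. -/

/-! ### Units, uniformizers and orders at a closed point -/

section OrderCalculus

variable {F : Type*} [Field F] {W : WeierstrassCurve F} {c : ClosedPoint W}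
  {f g t t' : W.toAffine.FunctionField} {k l : ℤ}

theorem IsRegularAt.one : IsRegularAt W c 1 := by
  cases c with
  | none => exact ⟨1, 1, by simp, by simp⟩
  | some m => exact ⟨1, 1, m.isMaximal.ne_top ∘ (Ideal.eq_top_iff_one _).mpr, by simp⟩

theorem IsRegularAt.mul (hf : IsRegularAt W c f) (hg : IsRegularAt W c g) :
    IsRegularAt W c (f * g) := by
  cases c with
  | none =>
    obtain ⟨A, B, hB, rfl⟩ := hf
    obtain ⟨A', B', hB', rfl⟩ := hg
    exact ⟨A * A', B * B', by simp [hB, hB'], by simp only [map_mul, div_mul_div_comm]⟩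
  | some m =>
    obtain ⟨a, b, hb, rfl⟩ := hf
    obtain ⟨a', b', hb', rfl⟩ := hg
    exact ⟨a * a', b * b', m.isMaximal.isPrime.mul_notMem hb hb',
      by simp only [map_mul, div_mul_div_comm]⟩

theorem IsUnitAt.one : IsUnitAt W c 1 :=
  ⟨one_ne_zero, .one, by simpa using IsRegularAt.one⟩

theorem IsUnitAt.mul (hf : IsUnitAt W c f) (hg : IsUnitAt W c g) : IsUnitAt W c (f * g) :=
  ⟨mul_ne_zero hf.1 hg.1, hf.2.1.mul hg.2.1, by rw [mul_inv]; exact hf.2.2.mul hg.2.2⟩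

theorem IsUnitAt.inv (hf : IsUnitAt W c f) : IsUnitAt W c f⁻¹ :=
  ⟨inv_ne_zero hf.1, hf.2.2, by simpa using hf.2.1⟩

theorem IsUnitAt.pow (hf : IsUnitAt W c f) (m : ℕ) : IsUnitAt W c (f ^ m) := by
  induction m with
  | zero => simpa using IsUnitAt.one
  | succ m ih => rw [pow_succ]; exact ih.mul hf

theorem IsUnitAt.zpow (hf : IsUnitAt W c f) (m : ℤ) : IsUnitAt W c (f ^ m) := by
  cases m with
  | ofNat m => simpa using hf.pow m
  | negSucc m => rw [zpow_negSucc]; exact (hf.pow _).inv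

theorem IsRegularAt.pow (hf : IsRegularAt W c f) (m : ℕ) : IsRegularAt W c (f ^ m) := by
  induction m with
  | zero => simpa using IsRegularAt.one
  | succ m ih => rw [pow_succ]; exact ih.mul hf

theorem IsUniformizerAt.not_isUnitAt_pow_succ (ht : IsUniformizerAt W c t) (m : ℕ) :
    ¬ IsUnitAt W c (t ^ (m + 1)) := by
  intro h
  have h0 : t ≠ 0 := fun h0 => h.1 (by simp [h0])
  refine ht.2.1 ⟨h0, ht.1, ?_⟩
  have : t⁻¹ = t ^ m * (t ^ (m + 1))⁻¹ := by
    rw [pow_succ, mul_inv, ← mul_assoc, mul_inv_cancel₀ (pow_ne_zero m h0), one_mul]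
  rw [this]
  exact (ht.1.pow m).mul h.2.2

theorem IsUniformizerAt.eq_zero_of_isUnitAt_zpow (ht : IsUniformizerAt W c t)
    (h : IsUnitAt W c (t ^ k)) : k = 0 := by
  rcases k with m | m
  · cases m with
    | zero => rfl
    | succ m => exact absurd (by exact_mod_cast h) (ht.not_isUnitAt_pow_succ m)
  · exact absurd (by simpa [zpow_negSucc] using h.inv) (ht.not_isUnitAt_pow_succ m)

theorem IsUniformizerAt.exists_isUnitAt_mul (ht : IsUniformizerAt W c t)
    (ht' : IsUniformizerAt W c t') : ∃ u, IsUnitAt W c u ∧ t' = t * u := by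
  obtain ⟨h, hh, e⟩ := ht.2.2 t' ht'.1 ht'.2.1
  obtain ⟨h', hh', e'⟩ := ht'.2.2 t ht.1 ht.2.1
  by_cases h0 : t = 0
  · exact ⟨1, .one, by simp [e, h0]⟩
  have e1 : h * h' = 1 := by
    apply mul_left_cancel₀ h0
    rw [mul_one, ← mul_assoc, ← e, ← e']
  exact ⟨h, ⟨left_ne_zero_of_mul_eq_one e1, hh, by rwa [inv_eq_of_mul_eq_one_right e1]⟩, e⟩

/-- `HasOrd` only provides some uniformizer. Two uniformizers differ by a unit, so any prescribed
one serves equally well. -/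
theorem HasOrd.exists_eq_zpow_mul (hf : HasOrd W c f k) (ht : IsUniformizerAt W c t) :
    ∃ u, IsUnitAt W c u ∧ f = t ^ k * u := by
  obtain ⟨t', u, ht', hu, rfl⟩ := hf
  obtain ⟨v, hv, rfl⟩ := ht.exists_isUnitAt_mul ht'
  exact ⟨v ^ k * u, (hv.zpow k).mul hu, by rw [mul_zpow, mul_assoc]⟩

theorem HasOrd.unique (hf : HasOrd W c f k) (hf' : HasOrd W c f l) (h0 : f ≠ 0) : k = l := by
  obtain ⟨t, u, ht, hu, e⟩ := hf
  obtain ⟨v, hv, e'⟩ := hf'.exists_eq_zpow_mul ht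
  -- The definition of a uniformizer admits `t = 0`, as would occur if the local ring were a field.
  -- Then `f ≠ 0` forces both exponents to be 0.
  by_cases ht0 : t = 0
  · have : ∀ {m : ℤ} {w}, f = t ^ m * w → m = 0 := fun {m w} e => by
      by_contra hm
      exact h0 (by rw [e, ht0, zero_zpow m hm, zero_mul])
    rw [this e, this e']
  · refine sub_eq_zero.mp (ht.eq_zero_of_isUnitAt_zpow ?_)
    have : t ^ (k - l) = v * u⁻¹ := by
      rw [zpow_sub₀ ht0, div_eq_iff (zpow_ne_zero _ ht0), mul_right_comm, eq_mul_inv_iff_mul_eq₀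
        hu.1, ← e, e', mul_comm]
    rw [this]
    exact hv.mul hu.inv

theorem HasOrd.mul (hf : HasOrd W c f k) (hg : HasOrd W c g l) (h0 : f * g ≠ 0) :
    HasOrd W c (f * g) (k + l) := by
  obtain ⟨t, u, ht, hu, rfl⟩ := hf
  obtain ⟨v, hv, rfl⟩ := hg.exists_eq_zpow_mul ht
  refine ⟨t, u * v, ht, hu.mul hv, ?_⟩
  by_cases ht0 : t = 0
  · subst ht0
    have hk : k = 0 := by by_contra hk; simp [zero_zpow k hk] at h0
    have hl : l = 0 := by by_contra hl; simp [zero_zpow l hl] at h0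
    simp [hk, hl]
  · rw [zpow_add₀ ht0]; ring

theorem HasOrd.inv (hf : HasOrd W c f k) : HasOrd W c f⁻¹ (-k) := by
  obtain ⟨t, u, ht, hu, rfl⟩ := hf
  exact ⟨t, u⁻¹, ht, hu.inv, by rw [mul_inv, zpow_neg]⟩

theorem IsUnitAt.hasOrd (hf : IsUnitAt W c f) (ht : IsUniformizerAt W c t) : HasOrd W c f 0 :=
  ⟨t, f, ht, hf, by simp⟩

end OrderCalculus

/-! ### The valuation at infinity from the degree of the norm -/

section DegreeValuation

open Polynomial WeierstrassCurve.Affine WithZero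

variable {F : Type*} [Field F] {W : WeierstrassCurve F}

theorem norm_coordinateRing_ne_zero {r : W.toAffine.CoordinateRing} (hr : r ≠ 0) :
    Algebra.norm F[X] r ≠ 0 := by
  have : Module.Finite F[X] W.toAffine.CoordinateRing :=
    Module.Finite.of_basis (CoordinateRing.basis W.toAffine)
  exact (Algebra.norm_ne_zero_iff (R := F[X])).mpr hr

/-- The norm of `p + q y` has degree `max (2 deg p) (2 deg q + 3)`: the two entries have different
parity, so nothing cancels. This expression is visibly ultrametric in `(p, q)`. -/
theorem degree_norm_add_le (r s : W.toAffine.CoordinateRing) :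
    (Algebra.norm F[X] (r + s)).degree ≤
      max (Algebra.norm F[X] r).degree (Algebra.norm F[X] s).degree := by
  obtain ⟨p, q, rfl⟩ := CoordinateRing.exists_smul_basis_eq r
  obtain ⟨p', q', rfl⟩ := CoordinateRing.exists_smul_basis_eq s
  rw [add_add_add_comm, ← add_smul, ← add_smul]
  simp only [CoordinateRing.degree_norm_smul_basis]
  refine max_le ?_ ?_
  · rcases le_max_iff.mp (degree_add_le p p') with h | h
    · exact (nsmul_le_nsmul_right h 2).trans (by simp)
    · exact (nsmul_le_nsmul_right h 2).trans (by simp)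
  · rcases le_max_iff.mp (degree_add_le q q') with h | h
    · exact (add_le_add_left (nsmul_le_nsmul_right h 2) 3).trans (by simp)
    · exact (add_le_add_left (nsmul_le_nsmul_right h 2) 3).trans (by simp)

open Classical in
/-- The valuation `r ↦ exp (deg (N r))` of the coordinate ring, given by the place at infinity. -/
noncomputable def degreeValuation (W : WeierstrassCurve F) :
    Valuation W.toAffine.CoordinateRing ℤᵐ⁰ where
  toFun r := if r = 0 then 0 else exp ((Algebra.norm F[X] r).natDegree : ℤ)
  map_zero' := by simp
  map_one' := by simp
  map_mul' r s := by
    by_cases hr : r = 0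
    · simp [hr]
    by_cases hs : s = 0
    · simp [hs]
    simp only [hr, hs, mul_eq_zero, or_self, if_false, map_mul]
    rw [natDegree_mul (norm_coordinateRing_ne_zero hr) (norm_coordinateRing_ne_zero hs),
      Nat.cast_add, exp_add]
  map_add_le_max' r s := by
    by_cases hr : r = 0
    · simp [hr]
    by_cases hs : s = 0
    · simp [hs]
    by_cases hrs : r + s = 0
    · simp [hrs]
    simp only [hr, hs, hrs, if_false]
    have h := degree_norm_add_le r s
    rw [degree_eq_natDegree (norm_coordinateRing_ne_zero hr),
      degree_eq_natDegree (norm_coordinateRing_ne_zero hs),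
      degree_eq_natDegree (norm_coordinateRing_ne_zero hrs)] at h
    rw [le_max_iff] at h ⊢
    simpa only [exp_le_exp, Nat.cast_le] using h

theorem degreeValuation_of_ne_zero {r : W.toAffine.CoordinateRing} (hr : r ≠ 0) :
    degreeValuation W r = exp ((Algebra.norm F[X] r).natDegree : ℤ) :=
  if_neg hr

theorem nonZeroDivisors_le_primeCompl_supp_degreeValuation :
    nonZeroDivisors W.toAffine.CoordinateRing ≤ (degreeValuation W).supp.primeCompl := by
  intro r hr h
  rw [SetLike.mem_coe, Valuation.mem_supp_iff,
    degreeValuation_of_ne_zero (nonZeroDivisors.ne_zero hr)] at h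
  exact exp_ne_zero h

/-- The valuation of the function field at the place at infinity. -/
noncomputable def inftyPlace (W : WeierstrassCurve F) : Valuation W.toAffine.FunctionField ℤᵐ⁰ :=
  (degreeValuation W).extendToLocalization nonZeroDivisors_le_primeCompl_supp_degreeValuation _

theorem inftyPlace_algebraMap (r : W.toAffine.CoordinateRing) :
    inftyPlace W (algebraMap _ _ r) = degreeValuation W r :=
  Valuation.extendToLocalization_apply_map_apply ..

theorem inftyPlace_smul_basis {p q : F[X]} {d : ℕ}
    (h : max (2 • p.degree) (2 • q.degree + 3) = d) :
    inftyPlace W (algebraMap _ _ (p • (1 : W.toAffine.CoordinateRing) +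
      q • CoordinateRing.mk W.toAffine X)) = exp (d : ℤ) := by
  rw [← CoordinateRing.degree_norm_smul_basis (W' := W.toAffine)] at h
  rw [inftyPlace_algebraMap, degreeValuation_of_ne_zero, natDegree_eq_of_degree_eq_some h]
  intro h0
  have : Module.Finite F[X] W.toAffine.CoordinateRing :=
    Module.Finite.of_basis (CoordinateRing.basis W.toAffine)
  rw [h0, Algebra.norm_zero, degree_zero] at h
  exact WithBot.bot_ne_coe h

theorem inftyPlace_xFun : inftyPlace W (xFun W) = exp 2 := by
  have := inftyPlace_smul_basis (W := W) (p := X) (q := 0) (d := 2) (by simp)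
  simpa [CoordinateRing.smul, xFun] using this

theorem inftyPlace_yFun : inftyPlace W (yFun W) = exp 3 := by
  have := inftyPlace_smul_basis (W := W) (p := 0) (q := 1) (d := 3) (by simp)
  simpa [CoordinateRing.smul, yFun] using this

theorem inftyPlace_algebraMap_base {a : F} (ha : a ≠ 0) :
    inftyPlace W (algebraMap F _ a) = 1 := by
  have := inftyPlace_smul_basis (W := W) (p := C a) (q := 0) (d := 0)
    (by simp [degree_C ha])
  rw [zero_smul, add_zero, CoordinateRing.smul, mul_one] at this
  exact this

theorem xFun_ne_zero : xFun W ≠ 0 := (inftyPlace W).ne_zero_iff.mp (by simp [inftyPlace_xFun])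

theorem yFun_ne_zero : yFun W ≠ 0 := (inftyPlace W).ne_zero_iff.mp (by simp [inftyPlace_yFun])

theorem inftyPlace_xFun_div_yFun_lt_one : inftyPlace W (xFun W / yFun W) < 1 := by
  rw [map_div₀, inftyPlace_xFun, inftyPlace_yFun, ← exp_sub, ← exp_zero, exp_lt_exp]
  norm_num

theorem inftyPlace_one_div_yFun_lt_one : inftyPlace W (1 / yFun W) < 1 := by
  rw [one_div, map_inv₀, inftyPlace_yFun, ← exp_neg, ← exp_zero, exp_lt_exp]
  norm_num

theorem equation_xFun_yFun : yFun W ^ 2 + algebraMap F _ W.a₁ * xFun W * yFun W +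
    algebraMap F _ W.a₃ * yFun W = xFun W ^ 3 + algebraMap F _ W.a₂ * xFun W ^ 2 +
      algebraMap F _ W.a₄ * xFun W + algebraMap F _ W.a₆ := by
  have h : CoordinateRing.mk W.toAffine W.toAffine.polynomial = 0 := AdjoinRoot.mk_self
  have h' := congrArg (algebraMap _ W.toAffine.FunctionField) h
  simp only [WeierstrassCurve.Affine.polynomial, map_sub, map_add, map_mul, map_pow, map_zero] at h'
  have e : ∀ a : F, algebraMap F W.toAffine.FunctionField a =
    algebraMap _ W.toAffine.FunctionField (CoordinateRing.mk W.toAffine (C (C a))) := fun a => rfl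
  simp only [xFun, yFun, e]
  linear_combination h'

end DegreeValuation

/-! ### The local ring at infinity in the coordinates `z = x / y`, `w = 1 / y` -/

section LocalRingAtInfinity

open MvPolynomial

variable {F : Type*} [Field F] {W : WeierstrassCurve F}

/-- Substitution of `x / y` and `1 / y` into polynomials in two variables. -/
noncomputable abbrev chartEval (W : WeierstrassCurve F) :
    MvPolynomial (Fin 2) F →ₐ[F] W.toAffine.FunctionField :=
  aeval ![xFun W / yFun W, 1 / yFun W]

theorem exists_eq_X_mul_add_X_mul {A : MvPolynomial (Fin 2) F} (hA : constantCoeff A = 0) :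
    ∃ C D, A = X 0 * C + X 1 * D := by
  have : ∀ A : MvPolynomial (Fin 2) F, ∃ C D, A = MvPolynomial.C (constantCoeff A) +
      (X 0 * C + X 1 * D) := by
    intro A
    induction A using MvPolynomial.induction_on with
    | C a => exact ⟨0, 0, by simp⟩
    | add p q hp hq =>
      obtain ⟨c, d, hp⟩ := hp
      obtain ⟨c', d', hq⟩ := hq
      refine ⟨c + c', d + d', ?_⟩
      conv_lhs => rw [hp, hq]
      rw [map_add, map_add]
      ring
    | mul_X p i _ =>
      fin_cases i
      · exact ⟨p, 0, by simp [mul_comm]⟩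
      · exact ⟨0, p, by simp [mul_comm]⟩
  obtain ⟨C, D, h⟩ := this A
  exact ⟨C, D, by simpa [hA] using h⟩

theorem inftyPlace_chartEval_le_one (A : MvPolynomial (Fin 2) F) :
    inftyPlace W (chartEval W A) ≤ 1 := by
  induction A using MvPolynomial.induction_on with
  | C a =>
    by_cases ha : a = 0
    · simp [ha]
    · rw [algHom_C, inftyPlace_algebraMap_base ha]
  | add p q hp hq =>
    rw [map_add]
    exact (Valuation.map_add _ _ _).trans (max_le hp hq)
  | mul_X p i hp =>
    rw [map_mul, map_mul]
    refine mul_le_one' hp ?_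
    fin_cases i
    · simpa [chartEval] using (inftyPlace_xFun_div_yFun_lt_one (W := W)).le
    · simpa [chartEval] using (inftyPlace_one_div_yFun_lt_one (W := W)).le

/-- The nonzero constant term has value 1, while `z` and `w` have value less than 1, so the
remaining terms cannot cancel it. Denominators in the local ring at infinity are therefore genuinely
nonzero. -/
theorem chartEval_ne_zero {B : MvPolynomial (Fin 2) F} (hB : constantCoeff B ≠ 0) :
    chartEval W B ≠ 0 := by
  intro h0
  obtain ⟨C, D, h⟩ := exists_eq_X_mul_add_X_mul (A := MvPolynomial.C (constantCoeff B) - B)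
    (by simp)
  have h1 := congrArg (chartEval W) h
  rw [map_sub, h0, sub_zero, algHom_C, map_add, map_mul, map_mul] at h1
  have h2 := inftyPlace_algebraMap_base (W := W) hB
  rw [h1] at h2
  refine absurd h2 (ne_of_lt ?_)
  refine Valuation.map_add_lt _ ?_ ?_ <;> rw [map_mul]
  · refine mul_lt_one_of_lt_of_le ?_ (inftyPlace_chartEval_le_one C)
    simpa [chartEval] using inftyPlace_xFun_div_yFun_lt_one (W := W)
  · refine mul_lt_one_of_lt_of_le ?_ (inftyPlace_chartEval_le_one D)
    simpa [chartEval] using inftyPlace_one_div_yFun_lt_one (W := W)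

theorem isRegularAt_chartEval (A : MvPolynomial (Fin 2) F) :
    IsRegularAt W none (chartEval W A) :=
  ⟨A, 1, by simp, by simp [chartEval]⟩

theorem isUnitAt_chartEval {B : MvPolynomial (Fin 2) F} (hB : constantCoeff B ≠ 0) :
    IsUnitAt W none (chartEval W B) :=
  ⟨chartEval_ne_zero hB, isRegularAt_chartEval B, 1, B, hB, by simp [chartEval]⟩

theorem not_isRegularAt_inv_div : ¬ IsRegularAt W none (xFun W / yFun W)⁻¹ := by
  rintro ⟨A, B, hB, h⟩
  have hz : xFun W / yFun W ≠ 0 := div_ne_zero xFun_ne_zero yFun_ne_zero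
  -- If `1 / z = A / B`, then `B - z A` evaluates to zero although its constant term is that of `B`.
  refine chartEval_ne_zero (W := W) (B := B - X 0 * A) (by simpa using hB) ?_
  have : chartEval W B = xFun W / yFun W * chartEval W A := by
    rw [inv_eq_iff_eq_inv, inv_div, eq_div_iff_mul_eq] at h
    · exact h.symm
    · rintro h0
      rw [h0, div_zero] at h
      exact hz h
  rw [map_sub, this, map_mul]
  simp [chartEval]

/-- The unit `1 + a₁ z + a₃ w - a₂ z² - a₄ z w - a₆ w²` in the equation of the curve near
infinity, which reads `w * inftyUnit = z³` for `z = x / y` and `w = 1 / y`. -/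
noncomputable def inftyUnit (W : WeierstrassCurve F) : MvPolynomial (Fin 2) F :=
  1 + C W.a₁ * X 0 + C W.a₃ * X 1 - C W.a₂ * X 0 ^ 2 - C W.a₄ * X 0 * X 1 - C W.a₆ * X 1 ^ 2

theorem constantCoeff_inftyUnit : constantCoeff (inftyUnit W) = 1 := by
  simp [inftyUnit]

theorem isUnitAt_inftyUnit : IsUnitAt W none (chartEval W (inftyUnit W)) :=
  isUnitAt_chartEval (by simp [constantCoeff_inftyUnit])

theorem yFun_eq_zpow_mul :
    yFun W = (xFun W / yFun W) ^ (-3 : ℤ) * chartEval W (inftyUnit W) := by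
  have hy := yFun_ne_zero (W := W)
  have hx := xFun_ne_zero (W := W)
  have h := equation_xFun_yFun (W := W)
  rw [zpow_neg, eq_inv_mul_iff_mul_eq₀ (zpow_ne_zero _ (div_ne_zero hx hy))]
  simp only [inftyUnit, map_add, map_sub, map_mul, map_pow, map_one, aeval_X, algHom_C,
    Matrix.cons_val_zero, Matrix.cons_val_one]
  rw [show ((3 : ℤ)) = ((3 : ℕ) : ℤ) from rfl, zpow_natCast]
  field_simp
  linear_combination -h

/-- The maximal ideal is generated by `z` and `w`, and `w = z³ / U` with `U` the unit `inftyUnit`,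
so `z` alone suffices. -/
theorem isUniformizerAt_infty : IsUniformizerAt W none (xFun W / yFun W) := by
  have hreg : IsRegularAt W none (xFun W / yFun W) := by
    simpa [chartEval] using isRegularAt_chartEval (W := W) (X 0)
  refine ⟨hreg, fun h => not_isRegularAt_inv_div h.2.2, ?_⟩
  rintro g ⟨A, B, hB, rfl⟩ hg
  by_cases hA : constantCoeff A = 0
  · obtain ⟨C, D, rfl⟩ := exists_eq_X_mul_add_X_mul hA
    -- Substituting `w = z³ / U` in `(z C + w D) / B` gives `z (C U + z² D) / (B U)`.
    refine ⟨chartEval W (C * inftyUnit W + X 0 ^ 2 * D) / chartEval W (B * inftyUnit W),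
      ⟨_, _, by simpa [constantCoeff_inftyUnit] using hB, rfl⟩, ?_⟩
    have hU := chartEval_ne_zero (W := W) (B := inftyUnit W) (by simp [constantCoeff_inftyUnit])
    have hB' := chartEval_ne_zero (W := W) hB
    have hw : 1 / yFun W * chartEval W (inftyUnit W) = (xFun W / yFun W) ^ 3 := by
      conv_lhs => rw [yFun_eq_zpow_mul]
      rw [one_div, mul_inv, mul_assoc, inv_mul_cancel₀ hU, mul_one, zpow_neg, inv_inv]
      rfl
    simp only [map_add, map_mul, map_pow, aeval_X, Matrix.cons_val_zero,
      Matrix.cons_val_one] at *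
    rw [← mul_div_assoc, div_eq_div_iff hB' (mul_ne_zero hB' hU)]
    linear_combination (aeval ![xFun W / yFun W, 1 / yFun W] B) *
      (aeval ![xFun W / yFun W, 1 / yFun W] D) * hw
  · exact absurd ((isUnitAt_chartEval hA).mul (isUnitAt_chartEval hB).inv)
      (by rwa [← div_eq_mul_inv])

theorem hasOrd_infty_line (l d : F) :
    HasOrd W none (yFun W - algebraMap F _ l * xFun W - algebraMap F _ d) (-3) := by
  -- The line is `y (1 - l z - d w)`, and `y = z⁻³ U`.
  refine ⟨_, _, isUniformizerAt_infty, isUnitAt_inftyUnit.mul (isUnitAt_chartEval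
    (B := 1 - C l * X 0 - C d * X 1) (by simp)), ?_⟩
  rw [← mul_assoc, ← yFun_eq_zpow_mul]
  have hy := yFun_ne_zero (W := W)
  simp only [map_sub, map_mul, map_one, aeval_X, algHom_C, Matrix.cons_val_zero,
    Matrix.cons_val_one]
  field_simp

theorem hasOrd_infty_xFun_sub (a : F) :
    HasOrd W none (xFun W - algebraMap F _ a) (-2) := by
  have hy := yFun_ne_zero (W := W)
  have hx := xFun_ne_zero (W := W)
  -- Since `U = z³ y = z² x`, one has `z² (x - a) = U - a z²`.
  refine ⟨_, _, isUniformizerAt_infty, isUnitAt_chartEval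
    (B := inftyUnit W - C a * X 0 ^ 2) (by simp [constantCoeff_inftyUnit]), ?_⟩
  have hz : xFun W / yFun W ≠ 0 := div_ne_zero hx hy
  have hU : chartEval W (inftyUnit W) = (xFun W / yFun W) ^ 3 * yFun W := by
    have h := yFun_eq_zpow_mul (W := W)
    rw [zpow_neg, eq_inv_mul_iff_mul_eq₀ (zpow_ne_zero _ hz)] at h
    exact h.symm
  rw [map_sub, hU, zpow_neg, eq_inv_mul_iff_mul_eq₀ (zpow_ne_zero _ hz)]
  simp only [map_mul, map_pow, aeval_X, algHom_C, Matrix.cons_val_zero]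
  rw [show ((2 : ℤ)) = ((2 : ℕ) : ℤ) from rfl, zpow_natCast]
  field_simp

end LocalRingAtInfinity

/-! ### Local generators of invertible fractional ideals -/

section LocalGenerators

open WeierstrassCurve.Affine nonZeroDivisors

variable {F : Type*} [Field F] {W : WeierstrassCurve F}
  {m : MaximalSpectrum W.toAffine.CoordinateRing}

theorem algebraMap_ne_zero_of_notMem {I : Ideal W.toAffine.CoordinateRing}
    {b : W.toAffine.CoordinateRing} (hb : b ∉ I) :
    algebraMap _ W.toAffine.FunctionField b ≠ 0 :=
  (map_ne_zero_iff _ (FaithfulSMul.algebraMap_injective _ _)).mpr fun h0 =>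
    hb (h0 ▸ I.zero_mem)

theorem IsRegularAt.add {f g : W.toAffine.FunctionField} (hf : IsRegularAt W (some m) f)
    (hg : IsRegularAt W (some m) g) : IsRegularAt W (some m) (f + g) := by
  obtain ⟨a, b, hb, rfl⟩ := hf
  obtain ⟨a', b', hb', rfl⟩ := hg
  exact ⟨a * b' + b * a', b * b', m.isMaximal.isPrime.mul_notMem hb hb',
    by simp only [map_mul, map_add, div_add_div _ _ (algebraMap_ne_zero_of_notMem hb)
      (algebraMap_ne_zero_of_notMem hb')]⟩

theorem isRegularAt_algebraMap (r : W.toAffine.CoordinateRing) :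
    IsRegularAt W (some m) (algebraMap _ _ r) :=
  ⟨r, 1, m.isMaximal.ne_top ∘ (Ideal.eq_top_iff_one _).mpr, by simp⟩

/-- The group of invertible fractional ideals of the coordinate ring. -/
abbrev InvertibleIdeal (W : WeierstrassCurve F) :=
  (FractionalIdeal W.toAffine.CoordinateRing⁰ W.toAffine.FunctionField)ˣ

/-- An invertible fractional ideal as a submodule of the function field. -/
noncomputable abbrev InvertibleIdeal.toSubmodule (J : InvertibleIdeal W) :
    Submodule W.toAffine.CoordinateRing W.toAffine.FunctionField :=
  (J : FractionalIdeal W.toAffine.CoordinateRing⁰ W.toAffine.FunctionField)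

theorem InvertibleIdeal.toSubmodule_one :
    InvertibleIdeal.toSubmodule (1 : InvertibleIdeal W) = 1 :=
  FractionalIdeal.coe_one

theorem InvertibleIdeal.toSubmodule_mul (J J' : InvertibleIdeal W) :
    (J * J').toSubmodule = J.toSubmodule * J'.toSubmodule :=
  FractionalIdeal.coe_mul _ _

/-- The local ring at an affine closed point, as a module over the coordinate ring. -/
def regularSubmodule (m : MaximalSpectrum W.toAffine.CoordinateRing) :
    Submodule W.toAffine.CoordinateRing W.toAffine.FunctionField where
  carrier := {f | IsRegularAt W (some m) f}
  add_mem' := IsRegularAt.add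
  zero_mem' := by simpa using isRegularAt_algebraMap (m := m) 0
  smul_mem' r f hf := by
    rw [Set.mem_ofPred_eq, Algebra.smul_def]
    exact (isRegularAt_algebraMap r).mul hf

theorem mem_regularSubmodule {f : W.toAffine.FunctionField} :
    f ∈ regularSubmodule m ↔ IsRegularAt W (some m) f := Iff.rfl

theorem one_le_regularSubmodule : 1 ≤ regularSubmodule m :=
  Submodule.one_le.mpr (mem_regularSubmodule.mpr .one)

/-- Idempotence of the local ring makes local generators multiplicative, so that they form a group
and divisors can be localized factor by factor. -/
theorem regularSubmodule_mul_self :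
    regularSubmodule m * regularSubmodule m = regularSubmodule m := by
  refine le_antisymm (Submodule.mul_le.mpr fun f hf g hg => mem_regularSubmodule.mpr
    ((mem_regularSubmodule.mp hf).mul (mem_regularSubmodule.mp hg))) ?_
  simpa using mul_le_mul_left (one_le_regularSubmodule (m := m)) (regularSubmodule m)

theorem mem_span_singleton_mul_regularSubmodule {f g : W.toAffine.FunctionField} :
    f ∈ Submodule.span _ {g} * regularSubmodule m ↔
      ∃ h, IsRegularAt W (some m) h ∧ f = g * h := by
  rw [Submodule.mem_span_singleton_mul]
  exact ⟨fun ⟨h, hh, e⟩ => ⟨h, hh, e.symm⟩, fun ⟨h, hh, e⟩ => ⟨h, hh, e.symm⟩⟩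

/-- The pairs of an invertible fractional ideal `J` and a function `g` that generates `J` locally
at `m`. -/
def localGenerators (m : MaximalSpectrum W.toAffine.CoordinateRing) :
    Subgroup (InvertibleIdeal W ×
      W.toAffine.FunctionFieldˣ) where
  carrier := {p | InvertibleIdeal.toSubmodule p.1 * regularSubmodule m =
    Submodule.span _ {(p.2 : W.toAffine.FunctionField)} * regularSubmodule m}
  one_mem' := by
    rw [Set.mem_ofPred_eq, Prod.fst_one, Prod.snd_one, InvertibleIdeal.toSubmodule_one,
      Submodule.one_eq_span, Units.val_one]
  mul_mem' {p q} hp hq := by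
    rw [Set.mem_ofPred_eq] at hp hq ⊢
    rw [Prod.fst_mul, Prod.snd_mul, Units.val_mul, InvertibleIdeal.toSubmodule_mul,
      ← Set.singleton_mul_singleton, ← Submodule.span_mul_span, ← regularSubmodule_mul_self,
      mul_mul_mul_comm, hp, hq, mul_mul_mul_comm]
  inv_mem' {p} hp := by
    rw [Set.mem_ofPred_eq] at hp ⊢
    have h1 : InvertibleIdeal.toSubmodule p.1 * InvertibleIdeal.toSubmodule p⁻¹.1 = 1 := by
      rw [← InvertibleIdeal.toSubmodule_mul, Prod.fst_inv, mul_inv_cancel,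
        InvertibleIdeal.toSubmodule_one]
    have h2 : Submodule.span W.toAffine.CoordinateRing {(p.2 : W.toAffine.FunctionField)} *
        Submodule.span W.toAffine.CoordinateRing {(p⁻¹.2 : W.toAffine.FunctionField)} = 1 := by
      rw [Submodule.span_mul_span, Set.singleton_mul_singleton, ← Units.val_mul, Prod.snd_inv,
        mul_inv_cancel, Units.val_one, Submodule.one_eq_span]
    generalize InvertibleIdeal.toSubmodule p⁻¹.1 = J' at *
    generalize InvertibleIdeal.toSubmodule p.1 = J at *
    generalize Submodule.span W.toAffine.CoordinateRing {(p.2 : W.toAffine.FunctionField)} = S at *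
    generalize Submodule.span W.toAffine.CoordinateRing
      {(p⁻¹.2 : W.toAffine.FunctionField)} = S' at *
    calc J' * regularSubmodule m = J' * (S' * (S * regularSubmodule m)) := by
          rw [← mul_assoc S', mul_comm S', h2, one_mul]
      _ = S' * (J * J' * regularSubmodule m) := by rw [← hp]; ring
      _ = S' * regularSubmodule m := by rw [h1, one_mul]

theorem mem_localGenerators
    {J : InvertibleIdeal W}
    {g : W.toAffine.FunctionFieldˣ} : (J, g) ∈ localGenerators m ↔
      J.toSubmodule * regularSubmodule m =
        Submodule.span _ {(g : W.toAffine.FunctionField)} * regularSubmodule m := Iff.rfl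

theorem toPrincipalIdeal_mem_localGenerators (g : W.toAffine.FunctionFieldˣ) :
    (toPrincipalIdeal W.toAffine.CoordinateRing W.toAffine.FunctionField g, g) ∈
      localGenerators m := by
  rw [mem_localGenerators, InvertibleIdeal.toSubmodule, coe_toPrincipalIdeal,
    FractionalIdeal.coe_spanSingleton]

theorem mem_localGenerators_iff_isUnitAt (g : W.toAffine.FunctionFieldˣ) :
    (1, g) ∈ localGenerators m ↔ IsUnitAt W (some m) g := by
  rw [mem_localGenerators, InvertibleIdeal.toSubmodule_one, one_mul]
  constructor
  · intro h
    have h1 : (1 : W.toAffine.FunctionField) ∈ regularSubmodule m :=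
      mem_regularSubmodule.mpr .one
    rw [h, mem_span_singleton_mul_regularSubmodule] at h1
    obtain ⟨u, hu, e⟩ := h1
    have h2 : (g : W.toAffine.FunctionField) ∈ regularSubmodule m := by
      rw [h, mem_span_singleton_mul_regularSubmodule]
      exact ⟨1, .one, by simp⟩
    exact ⟨g.ne_zero, h2, by rwa [inv_eq_of_mul_eq_one_right e.symm]⟩
  · rintro ⟨h0, h1, h2⟩
    ext f
    rw [mem_span_singleton_mul_regularSubmodule, mem_regularSubmodule]
    constructor
    · exact fun hf => ⟨(g : W.toAffine.FunctionField)⁻¹ * f, h2.mul hf, by field_simp⟩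
    · rintro ⟨f, hf, rfl⟩
      exact h1.mul hf

theorem isUnitAt_div_of_mem_localGenerators
    {J : InvertibleIdeal W}
    {g g' : W.toAffine.FunctionFieldˣ} (h : (J, g) ∈ localGenerators m)
    (h' : (J, g') ∈ localGenerators m) :
    IsUnitAt W (some m) (g / g' : W.toAffine.FunctionField) := by
  have := (mem_localGenerators_iff_isUnitAt (g / g')).mp
    (by simpa using (localGenerators m).div_mem h h')
  simpa using this

/-- Being contained in `F[W]` is a local property; applied to `J` and to `J⁻¹`, it gives both
inclusions. -/
theorem eq_one_of_forall_mem_localGenerators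
    {J : InvertibleIdeal W}
    (h : ∀ m : MaximalSpectrum W.toAffine.CoordinateRing, (J, 1) ∈ localGenerators m) :
    J = 1 := by
  have key : ∀ J : InvertibleIdeal W,
      (∀ m : MaximalSpectrum W.toAffine.CoordinateRing, (J, 1) ∈ localGenerators m) →
      (J : FractionalIdeal W.toAffine.CoordinateRing⁰ W.toAffine.FunctionField) ≤ 1 := by
    intro J h f hf
    -- `I` is the ideal of denominators of `f`, that is, of all `r` with `r f` in `F[W]`. Regularity
    -- of `f` at each maximal ideal keeps `I` from lying in any of them.
    let I : Ideal W.toAffine.CoordinateRing :=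
      (1 : Submodule W.toAffine.CoordinateRing W.toAffine.FunctionField).comap
        (LinearMap.toSpanSingleton _ _ f)
    have hI : I = ⊤ := by
      by_contra hI
      obtain ⟨M, hM, hIM⟩ := Ideal.exists_le_maximal I hI
      have hm := h ⟨M, hM⟩
      rw [mem_localGenerators, Units.val_one, ← Submodule.one_eq_span, one_mul] at hm
      have hf' : f ∈ regularSubmodule ⟨M, hM⟩ := by
        rw [← hm, ← mul_one f]
        exact Submodule.mul_mem_mul hf (mem_regularSubmodule.mpr .one)
      obtain ⟨a, b, hb, e⟩ := hf'
      refine hb (hIM ?_)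
      have hb0 : algebraMap _ W.toAffine.FunctionField b ≠ 0 :=
        algebraMap_ne_zero_of_notMem hb
      simp only [I, Submodule.mem_comap, LinearMap.toSpanSingleton_apply, Submodule.mem_one]
      exact ⟨a, by rw [e, Algebra.smul_def, mul_div_cancel₀ _ hb0]⟩
    have h1 : (1 : W.toAffine.CoordinateRing) ∈ I := hI ▸ Submodule.mem_top
    simp only [I, Submodule.mem_comap, LinearMap.toSpanSingleton_apply, Submodule.mem_one,
      one_smul] at h1
    exact (FractionalIdeal.mem_one_iff _).mpr h1
  have h1 := key J h
  have h2 := key J⁻¹ fun m => by simpa using (localGenerators m).inv_mem (h m)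
  refine Units.ext (le_antisymm h1 ?_)
  calc (1 : FractionalIdeal W.toAffine.CoordinateRing⁰ W.toAffine.FunctionField)
      = J * (J⁻¹ : InvertibleIdeal W) := by rw [← Units.val_mul, mul_inv_cancel, Units.val_one]
    _ ≤ J * 1 := mul_le_mul_right h2 _
    _ = J := mul_one _

/-- An element of `I` outside `m` is a unit of the local ring, so `I` becomes the unit ideal there.
-/
theorem mem_localGenerators_of_not_le
    {J : InvertibleIdeal W}
    {I : Ideal W.toAffine.CoordinateRing}
    (hJ : (J : FractionalIdeal W.toAffine.CoordinateRing⁰ W.toAffine.FunctionField) = I)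
    (hI : ¬ I ≤ m.asIdeal) : (J, 1) ∈ localGenerators m := by
  obtain ⟨s, hs, hsm⟩ := SetLike.not_le_iff_exists.mp hI
  rw [mem_localGenerators, Units.val_one, ← Submodule.one_eq_span, one_mul,
    InvertibleIdeal.toSubmodule, hJ,
    FractionalIdeal.coe_coeIdeal]
  refine le_antisymm (Submodule.mul_le.mpr ?_) ?_
  · rintro _ ⟨r, _, rfl⟩ g hg
    exact (isRegularAt_algebraMap r).mul hg
  · intro f hf
    have hs0 : algebraMap _ W.toAffine.FunctionField s ≠ 0 :=
      algebraMap_ne_zero_of_notMem hsm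
    have : f = algebraMap _ _ s * ((algebraMap _ _ s)⁻¹ * f) := by field_simp
    rw [this]
    refine Submodule.mul_mem_mul ⟨s, hs, rfl⟩ (mem_regularSubmodule.mpr
      (IsRegularAt.mul ⟨1, s, hsm, by simp⟩ (mem_regularSubmodule.mp hf)))

/-- An invertible maximal ideal is locally principal: as `J J⁻¹ = 1` is not contained in `m`, some
`t s = r` with `t ∈ m`, `s ∈ J⁻¹`, `r ∉ m`. Each `a ∈ m` then equals `t (a s) / r` with `a s` in
`F[W]`, so `t` generates. -/
theorem exists_isUniformizerAt_mem_localGenerators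
    {J : InvertibleIdeal W}
    (hJ : (J : FractionalIdeal W.toAffine.CoordinateRing⁰ W.toAffine.FunctionField) = m.asIdeal) :
    ∃ t : W.toAffine.FunctionFieldˣ, IsUniformizerAt W (some m) (t : W.toAffine.FunctionField) ∧
      (J, t) ∈ localGenerators m := by
  have hinj := FaithfulSMul.algebraMap_injective W.toAffine.CoordinateRing W.toAffine.FunctionField
  -- some product of an element of `J` and one of `J⁻¹` is a unit at `m`
  obtain ⟨t, ht, s, hs, r, hr, hts⟩ : ∃ t ∈ m.asIdeal, ∃ s ∈ ((J⁻¹ : InvertibleIdeal W) :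
      FractionalIdeal W.toAffine.CoordinateRing⁰ W.toAffine.FunctionField),
      ∃ r ∉ m.asIdeal, algebraMap _ W.toAffine.FunctionField t * s = algebraMap _ _ r := by
    by_contra! hcon
    have hle : (J * (J⁻¹ : InvertibleIdeal W) :
        FractionalIdeal W.toAffine.CoordinateRing⁰ W.toAffine.FunctionField) ≤ m.asIdeal := by
      rw [FractionalIdeal.mul_le]
      intro a ha b hb
      have h1 : a * b ∈ (1 : FractionalIdeal W.toAffine.CoordinateRing⁰
          W.toAffine.FunctionField) := by
        rw [← Units.mul_inv J]
        exact FractionalIdeal.mul_mem_mul ha hb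
      obtain ⟨r, hr⟩ := (FractionalIdeal.mem_one_iff _).mp h1
      rw [hJ] at ha
      obtain ⟨a', ha', rfl⟩ := (FractionalIdeal.mem_coeIdeal _).mp ha
      rw [← hr]
      refine FractionalIdeal.mem_coeIdeal_of_mem _ ?_
      by_contra hrm
      exact hcon a' ha' b hb r hrm hr.symm
    rw [Units.mul_inv, ← FractionalIdeal.coeIdeal_top,
      FractionalIdeal.coeIdeal_le_coeIdeal] at hle
    exact m.isMaximal.ne_top (top_le_iff.mp hle)
  have hr0 : algebraMap _ W.toAffine.FunctionField r ≠ 0 :=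
    algebraMap_ne_zero_of_notMem hr
  have ht0 : algebraMap _ W.toAffine.FunctionField t ≠ 0 := fun h0 =>
    hr0 (by rw [← hts, h0, zero_mul])
  have key : ∀ a ∈ m.asIdeal, ∃ h, IsRegularAt W (some m) h ∧
      algebraMap _ W.toAffine.FunctionField a = algebraMap _ _ t * h := by
    intro a ha
    have h1 : algebraMap _ W.toAffine.FunctionField a * s ∈
        (1 : FractionalIdeal W.toAffine.CoordinateRing⁰ W.toAffine.FunctionField) := by
      rw [← Units.mul_inv J]
      exact FractionalIdeal.mul_mem_mul (hJ ▸ FractionalIdeal.mem_coeIdeal_of_mem _ ha) hs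
    obtain ⟨b, hb⟩ := (FractionalIdeal.mem_one_iff _).mp h1
    refine ⟨_, ⟨b, r, hr, rfl⟩, ?_⟩
    rw [hb, ← hts]
    have hs0 : s ≠ 0 := fun h0 => hr0 (by rw [← hts, h0, mul_zero])
    field_simp
  refine ⟨Units.mk0 _ ht0, ⟨isRegularAt_algebraMap t, ?_, ?_⟩, ?_⟩
  · rintro ⟨-, -, a, b, hb, e⟩
    rw [Units.val_mk0, inv_eq_iff_eq_inv, inv_div] at e
    have ha0 : algebraMap _ W.toAffine.FunctionField a ≠ 0 := fun h0 =>
      ht0 (by rw [e, h0, div_zero])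
    rw [eq_div_iff ha0, ← map_mul] at e
    exact hb (hinj e ▸ m.asIdeal.mul_mem_right _ ht)
  · rintro g ⟨a, b, hb, rfl⟩ hg
    by_cases ha : a ∈ m.asIdeal
    · obtain ⟨h, hh, e⟩ := key a ha
      refine ⟨h * (algebraMap _ _ b)⁻¹, hh.mul ⟨1, b, hb, by simp⟩, ?_⟩
      rw [e, Units.val_mk0, div_eq_mul_inv, mul_assoc]
    · exact absurd ⟨div_ne_zero (algebraMap_ne_zero_of_notMem ha)
        (algebraMap_ne_zero_of_notMem hb), ⟨a, b, hb, rfl⟩,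
        b, a, ha, inv_div _ _⟩ hg
  · rw [mem_localGenerators, InvertibleIdeal.toSubmodule, hJ, FractionalIdeal.coe_coeIdeal]
    refine le_antisymm (Submodule.mul_le.mpr ?_) ?_
    · rintro _ ⟨a, ha, rfl⟩ g hg
      obtain ⟨h, hh, e⟩ := key a ha
      rw [mem_span_singleton_mul_regularSubmodule]
      exact ⟨h * g, hh.mul hg, by rw [← mul_assoc]; exact congrArg (· * g) e⟩
    · refine mul_le_mul_left ?_ _
      rw [Submodule.span_singleton_le_iff_mem]
      exact ⟨t, ht, rfl⟩

end LocalGenerators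

/-! ### Ideals of rational points, the group law and degrees -/

section PointIdeals

open WeierstrassCurve.Affine nonZeroDivisors

variable {F : Type*} [Field F] {W : WeierstrassCurve F}

/-- The invertible ideal of a rational point, the point at infinity having the unit ideal. -/
noncomputable def pointIdeal : W.toAffine.Point → InvertibleIdeal W
  | .zero => 1
  | .some _ _ h => CoordinateRing.XYIdeal' (W := W.toAffine) h

theorem pointIdeal_zero : pointIdeal (0 : W.toAffine.Point) = 1 := rfl

theorem pointIdeal_some {x y : F} (h : W.toAffine.Nonsingular x y) :
    (pointIdeal (.some x y h : W.toAffine.Point) :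
      FractionalIdeal W.toAffine.CoordinateRing⁰ W.toAffine.FunctionField) =
      CoordinateRing.XYIdeal W.toAffine x (Polynomial.C y) := rfl

theorem mk_pointIdeal [DecidableEq F] (Q : W.toAffine.Point) :
    ClassGroup.mk W.toAffine.FunctionField (pointIdeal Q) =
      Additive.toMul (Point.toClass (W := W.toAffine) Q) := by
  cases Q with
  | zero => exact map_one _
  | some x y h => rfl

/-- Affine points with equal ideals have equal ideal classes, and the class determines the point. -/
theorem toClosedPoint_injective [DecidableEq F] : Function.Injective (toClosedPoint W) := by
  intro Q Q' h
  cases Q with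
  | zero =>
    cases Q' with
    | zero => rfl
    | some x' y' h' => cases h
  | some x y hxy =>
    cases Q' with
    | zero => cases h
    | some x' y' hxy' =>
      refine Point.toClass_injective (W := W.toAffine) (Additive.toMul.injective ?_)
      rw [← mk_pointIdeal, ← mk_pointIdeal]
      congr 1
      refine Units.ext ?_
      rw [pointIdeal_some, pointIdeal_some]
      congr 1
      simpa [toClosedPoint] using h

variable {m : MaximalSpectrum W.toAffine.CoordinateRing}

theorem pointIdeal_mem_localGenerators {Q : W.toAffine.Point} (hQ : toClosedPoint W Q ≠ some m) :
    (pointIdeal Q, 1) ∈ localGenerators m := by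
  cases Q with
  | zero => exact (localGenerators m).one_mem
  | some x y h =>
    refine mem_localGenerators_of_not_le (pointIdeal_some h) fun hle => hQ ?_
    have := (isMaximal_XYIdeal W h).eq_of_le m.isMaximal.ne_top hle
    simp only [toClosedPoint, this]

theorem exists_isUniformizerAt_pointIdeal {Q : W.toAffine.Point}
    (hQ : toClosedPoint W Q = some m) :
    ∃ t : W.toAffine.FunctionFieldˣ, IsUniformizerAt W (some m) (t : W.toAffine.FunctionField) ∧
      (pointIdeal Q, t) ∈ localGenerators m := by
  cases Q with
  | zero => cases hQ
  | some x y h =>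
    refine exists_isUniformizerAt_mem_localGenerators ?_
    simp only [toClosedPoint, Option.some.injEq] at hQ
    rw [pointIdeal_some, ← hQ]

theorem algebraMap_XClass (x : F) : algebraMap _ W.toAffine.FunctionField
    (CoordinateRing.XClass W.toAffine x) = xFun W - algebraMap F _ x := by
  simp only [CoordinateRing.XClass, xFun, map_sub]
  rfl

theorem algebraMap_YClass (x y l : F) : algebraMap _ W.toAffine.FunctionField
    (CoordinateRing.YClass W.toAffine (linePolynomial x y l)) =
      yFun W - algebraMap F _ l * xFun W - algebraMap F _ (y - l * x) := by
  have e : ∀ a : F, algebraMap F W.toAffine.FunctionField a =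
    algebraMap _ W.toAffine.FunctionField
      (CoordinateRing.mk W.toAffine (Polynomial.C (Polynomial.C a))) := fun a => rfl
  simp only [CoordinateRing.YClass, linePolynomial, xFun, yFun, e, map_sub, map_add, map_mul]
  ring

/-- The principal ideal of a nonzero function. -/
noncomputable abbrev principalIdeal : W.toAffine.FunctionFieldˣ →* InvertibleIdeal W :=
  toPrincipalIdeal W.toAffine.CoordinateRing W.toAffine.FunctionField

theorem coe_principalIdeal_algebraMap {r : W.toAffine.CoordinateRing}
    (hr : algebraMap _ W.toAffine.FunctionField r ≠ 0) :
    (principalIdeal (Units.mk0 _ hr) :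
      FractionalIdeal W.toAffine.CoordinateRing⁰ W.toAffine.FunctionField) =
      (Ideal.span {r} : Ideal W.toAffine.CoordinateRing) := by
  rw [coe_toPrincipalIdeal, FractionalIdeal.coeIdeal_span_singleton, Units.val_mk0]

theorem HasOrd.mul_units {c : ClosedPoint W} {f g : W.toAffine.FunctionFieldˣ} {k l : ℤ}
    (hf : HasOrd W c (f : W.toAffine.FunctionField) k)
    (hg : HasOrd W c (g : W.toAffine.FunctionField) l) :
    HasOrd W c ((f * g : W.toAffine.FunctionFieldˣ) : W.toAffine.FunctionField) (k + l) := by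
  rw [Units.val_mul]
  exact hf.mul hg (mul_ne_zero f.ne_zero g.ne_zero)

theorem HasOrd.inv_units {c : ClosedPoint W} {f : W.toAffine.FunctionFieldˣ} {k : ℤ}
    (hf : HasOrd W c (f : W.toAffine.FunctionField) k) :
    HasOrd W c ((f⁻¹ : W.toAffine.FunctionFieldˣ) : W.toAffine.FunctionField) (-k) := by
  rw [Units.val_inv_eq_inv_val]
  exact hf.inv

open Classical in
/-- The degree of the affine part of the divisor of a rational point. -/
noncomputable def affineDegree (Q : W.toAffine.Point) : ℤ := if Q = 0 then 0 else 1

theorem affineDegree_zero : affineDegree (0 : W.toAffine.Point) = 0 := if_pos rfl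

theorem affineDegree_some {x y : F} (h : W.toAffine.Nonsingular x y) :
    affineDegree (.some x y h : W.toAffine.Point) = 1 := if_neg (Point.some_ne_zero h)

theorem one_hasOrd_infty : HasOrd W none 1 0 := IsUnitAt.one.hasOrd isUniformizerAt_infty

/-- This is the chord-tangent construction with its order at infinity: `h` has affine divisor `(Q) +
(Q') - (Q + Q')`, points at infinity omitted, and its order at infinity is minus the degree of that
divisor. -/
theorem exists_pointIdeal_mul_pointIdeal [DecidableEq F] (Q Q' : W.toAffine.Point) :
    ∃ h : W.toAffine.FunctionFieldˣ,
      pointIdeal Q * pointIdeal Q' = principalIdeal h * pointIdeal (Q + Q') ∧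
      HasOrd W none (h : W.toAffine.FunctionField)
        (affineDegree (Q + Q') - affineDegree Q - affineDegree Q') := by
  have hne : ∀ {r}, r ≠ 0 → algebraMap W.toAffine.CoordinateRing W.toAffine.FunctionField r ≠ 0 :=
    fun h => (map_ne_zero_iff _ (FaithfulSMul.algebraMap_injective _ _)).mpr h
  rcases Q with _ | ⟨x, y, h⟩
  · refine ⟨1, ?_, ?_⟩
    · rw [Point.zero_def.symm, zero_add, pointIdeal_zero, map_one]
    · rw [Point.zero_def.symm, zero_add, affineDegree_zero, sub_zero, sub_self, Units.val_one]
      exact one_hasOrd_infty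
  rcases Q' with _ | ⟨x', y', h'⟩
  · refine ⟨1, ?_, ?_⟩
    · rw [Point.zero_def.symm, add_zero, pointIdeal_zero, map_one, mul_one, one_mul]
    · rw [Point.zero_def.symm, add_zero, affineDegree_zero, sub_zero, sub_self, Units.val_one]
      exact one_hasOrd_infty
  -- For opposite points `h` is the vertical line `x - x(Q)`, of order `-2`.
  by_cases hxy : x = x' ∧ y = W.toAffine.negY x' y'
  · obtain ⟨rfl, rfl⟩ := hxy
    have hX := hne (CoordinateRing.XClass_ne_zero (W' := W.toAffine) x)
    rw [Point.add_of_Y_eq rfl rfl]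
    refine ⟨Units.mk0 _ hX, ?_, ?_⟩
    · rw [pointIdeal_zero, mul_one]
      refine Units.ext ?_
      rw [coe_principalIdeal_algebraMap hX, Units.val_mul, pointIdeal_some, pointIdeal_some,
        ← FractionalIdeal.coeIdeal_mul, CoordinateRing.XYIdeal_neg_mul h', CoordinateRing.XIdeal]
    · rw [affineDegree_zero, affineDegree_some, affineDegree_some, Units.val_mk0,
        algebraMap_XClass]
      exact hasOrd_infty_xFun_sub x
  · rw [Point.add_some hxy]
    set l := W.toAffine.slope x x' y y'
    have hX := hne (CoordinateRing.XClass_ne_zero (W' := W.toAffine) (W.toAffine.addX x x' l))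
    have hY := hne (CoordinateRing.YClass_ne_zero (W' := W.toAffine) (linePolynomial x y l))
    -- The line through the two points divided by the vertical line through their sum, of order `-3
    -- + 2 = -1`.
    refine ⟨(Units.mk0 _ hX)⁻¹ * Units.mk0 _ hY, ?_, ?_⟩
    · rw [map_mul, map_inv, mul_assoc, eq_inv_mul_iff_mul_eq]
      refine Units.ext ?_
      simp only [Units.val_mul]
      rw [coe_principalIdeal_algebraMap hX, coe_principalIdeal_algebraMap hY, pointIdeal_some,
        pointIdeal_some, pointIdeal_some]
      simp only [← FractionalIdeal.coeIdeal_mul]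
      congr 1
      exact CoordinateRing.XYIdeal_mul_XYIdeal h.1 h'.1 hxy
    · rw [affineDegree_some, affineDegree_some, affineDegree_some]
      have h1 : HasOrd W none ((Units.mk0 _ hX : W.toAffine.FunctionFieldˣ) :
          W.toAffine.FunctionField) (-2) := by
        rw [Units.val_mk0, algebraMap_XClass]
        exact hasOrd_infty_xFun_sub _
      have h2 : HasOrd W none ((Units.mk0 _ hY : W.toAffine.FunctionFieldˣ) :
          W.toAffine.FunctionField) (-3) := by
        rw [Units.val_mk0, algebraMap_YClass]
        exact hasOrd_infty_line _ _
      exact h1.inv_units.mul_units h2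

/-- The pairs `(J, d)` of an invertible ideal linearly equivalent to the ideal of a rational point
and its degree `d`, computed from the order of vanishing at infinity. -/
noncomputable def degreeGraph [DecidableEq F] (W : WeierstrassCurve F) :
    Subgroup (InvertibleIdeal W × Multiplicative ℤ) where
  carrier := {p | ∃ (f : W.toAffine.FunctionFieldˣ) (Q : W.toAffine.Point),
    p.1 = principalIdeal f * pointIdeal Q ∧
      HasOrd W none (f : W.toAffine.FunctionField) (affineDegree Q - p.2.toAdd)}
  one_mem' := ⟨1, 0, by rw [map_one, pointIdeal_zero, mul_one, Prod.fst_one],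
    by simpa [affineDegree_zero] using one_hasOrd_infty⟩
  mul_mem' := by
    rintro ⟨J, d⟩ ⟨J', d'⟩ ⟨f, Q, rfl, hf⟩ ⟨f', Q', rfl, hf'⟩
    obtain ⟨h, e, hh⟩ := exists_pointIdeal_mul_pointIdeal Q Q'
    refine ⟨f * f' * h, Q + Q', ?_, ?_⟩
    · rw [Prod.mk_mul_mk, mul_mul_mul_comm, e, map_mul, map_mul, mul_assoc, mul_assoc, mul_assoc]
    · convert (hf.mul_units hf').mul_units hh using 1
      simp only [Prod.mk_mul_mk, toAdd_mul]
      ring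
  inv_mem' := by
    rintro ⟨J, d⟩ ⟨f, Q, rfl, hf⟩
    obtain ⟨h, e, hh⟩ := exists_pointIdeal_mul_pointIdeal Q (-Q)
    refine ⟨f⁻¹ * h⁻¹, -Q, ?_, ?_⟩
    · rw [Prod.inv_mk, map_mul, map_inv, map_inv, mul_inv, mul_assoc, mul_right_inj,
        eq_inv_mul_iff_mul_eq, mul_inv_eq_iff_eq_mul]
      rw [add_neg_cancel, pointIdeal_zero, mul_one] at e
      rw [← e, mul_comm]
    · convert hf.inv_units.mul_units hh.inv_units using 1
      simp only [Prod.inv_mk, toAdd_inv, add_neg_cancel, affineDegree_zero]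
      ring

theorem pointIdeal_mem_degreeGraph [DecidableEq F] (Q : W.toAffine.Point) :
    (pointIdeal Q, Multiplicative.ofAdd (affineDegree Q)) ∈ degreeGraph W :=
  ⟨1, Q, by rw [map_one, one_mul], by simpa using one_hasOrd_infty⟩

/-- The norm of a unit has degree 0, and the degree formula then leaves only nonzero constants. -/
theorem isUnitAt_infty_of_isUnit {r : W.toAffine.CoordinateRing} (hr : IsUnit r) :
    IsUnitAt W none (algebraMap _ W.toAffine.FunctionField r) := by
  have hdeg := Polynomial.degree_eq_zero_of_isUnit (hr.map (Algebra.norm (Polynomial F)))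
  obtain ⟨p, q, rfl⟩ := CoordinateRing.exists_smul_basis_eq r
  rw [CoordinateRing.degree_norm_smul_basis] at hdeg
  have hq : q = 0 := by
    by_contra hq
    have := (le_max_right _ _).trans hdeg.le
    rw [Polynomial.degree_eq_natDegree hq] at this
    have h2 : ((2 * q.natDegree + 3 : ℕ) : WithBot ℕ) ≤ ((0 : ℕ) : WithBot ℕ) := by
      simpa [nsmul_eq_mul] using this
    have h3 : 2 * q.natDegree + 3 ≤ 0 := WithBot.coe_le_coe.mp h2
    omega
  have hp : p.degree ≤ 0 := by
    by_cases hp : p = 0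
    · simp [hp]
    have := (le_max_left _ _).trans hdeg.le
    rw [Polynomial.degree_eq_natDegree hp] at this ⊢
    have h2 : ((2 * p.natDegree : ℕ) : WithBot ℕ) ≤ ((0 : ℕ) : WithBot ℕ) := by
      simpa [nsmul_eq_mul] using this
    have h3 : 2 * p.natDegree ≤ 0 := WithBot.coe_le_coe.mp h2
    exact_mod_cast (show p.natDegree ≤ 0 by omega)
  rw [Polynomial.eq_C_of_degree_le_zero hp] at hr ⊢
  subst hq
  set a := p.coeff 0
  rw [zero_smul, add_zero] at hr ⊢
  have ha : a ≠ 0 := by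
    rintro ha
    rw [ha, map_zero, zero_smul] at hr
    exact not_isUnit_zero hr
  have e : algebraMap _ W.toAffine.FunctionField
      (Polynomial.C a • (1 : W.toAffine.CoordinateRing)) = chartEval W (MvPolynomial.C a) := by
    rw [MvPolynomial.algHom_C, CoordinateRing.smul, mul_one]
    rfl
  rw [e]
  exact isUnitAt_chartEval (by simpa using ha)

theorem isUnitAt_infty_of_principalIdeal_eq_one {f : W.toAffine.FunctionFieldˣ}
    (hf : principalIdeal f = 1) : IsUnitAt W none (f : W.toAffine.FunctionField) := by
  have key : ∀ g : W.toAffine.FunctionFieldˣ, principalIdeal g = 1 →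
      ∃ r, algebraMap W.toAffine.CoordinateRing _ r = (g : W.toAffine.FunctionField) := by
    intro g hg
    have h1 : (g : W.toAffine.FunctionField) ∈ (principalIdeal g :
        FractionalIdeal W.toAffine.CoordinateRing⁰ W.toAffine.FunctionField) := by
      rw [coe_toPrincipalIdeal]
      exact FractionalIdeal.mem_spanSingleton_self _ _
    rw [hg, Units.val_one] at h1
    exact (FractionalIdeal.mem_one_iff _).mp h1
  obtain ⟨r, hr⟩ := key f hf
  obtain ⟨s, hs⟩ := key f⁻¹ (by rw [map_inv, hf, inv_one])
  rw [← hr]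
  refine isUnitAt_infty_of_isUnit (IsUnit.of_mul_eq_one s ?_)
  apply FaithfulSMul.algebraMap_injective _ W.toAffine.FunctionField
  rw [map_mul, hr, hs, Units.mul_inv, map_one]

/-- The graph supplies `g` and `Q` with `(f) = (g) I_Q`. The class of `Q` is trivial, hence `Q = O`;
so `f / g` generates the unit ideal and has order 0 at infinity, and `f` inherits the order of `g`.
-/
theorem hasOrd_infty_of_mem_degreeGraph [DecidableEq F] {f : W.toAffine.FunctionFieldˣ} {d : ℤ}
    (h : (principalIdeal f, Multiplicative.ofAdd d) ∈ degreeGraph W) :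
    HasOrd W none (f : W.toAffine.FunctionField) (-d) := by
  obtain ⟨g, Q, e, hg⟩ := h
  have hQ : Q = 0 := by
    rw [← Point.toClass_eq_zero (W := W.toAffine), ← toMul_eq_one, ← mk_pointIdeal]
    have e' := congrArg (ClassGroup.mk W.toAffine.FunctionField) e
    rw [map_mul] at e'
    have h1 : ∀ f : W.toAffine.FunctionFieldˣ,
        ClassGroup.mk W.toAffine.FunctionField (principalIdeal f) = 1 := fun f => by
      rw [← map_one (ClassGroup.mk W.toAffine.FunctionField), eq_comm, ClassGroup.mk_eq_mk]
      exact ⟨f, one_mul _⟩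
    rwa [h1, h1, one_mul, eq_comm] at e'
  subst hQ
  rw [pointIdeal_zero, mul_one] at e
  have hu : principalIdeal (f * g⁻¹) = 1 := by
    rw [map_mul, map_inv, mul_inv_eq_one]
    exact e
  have := ((isUnitAt_infty_of_principalIdeal_eq_one hu).hasOrd isUniformizerAt_infty).mul_units hg
  simpa [affineDegree_zero] using this

end PointIdeals

/-! ### Abel's theorem for divisors supported on rational points -/

section Divisors

open WeierstrassCurve.Affine nonZeroDivisors

variable {F : Type*} [Field F] {W : WeierstrassCurve F} {n : ℕ}

/-- The fractional ideal of the affine part of the divisor `∑ x_i (P i)`. -/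
noncomputable def divisorIdeal (P : Fin n → W.toAffine.Point) (x : Fin n → ℤ) :
    InvertibleIdeal W :=
  ∏ i, pointIdeal (P i) ^ x i

theorem mk_divisorIdeal_eq_one_iff [DecidableEq F] (P : Fin n → W.toAffine.Point)
    (x : Fin n → ℤ) :
    ClassGroup.mk W.toAffine.FunctionField (divisorIdeal P x) = 1 ↔ ∑ i, x i • P i = 0 := by
  rw [← Point.toClass_eq_zero (W := W.toAffine), ← toMul_eq_one, map_sum, toMul_sum,
    divisorIdeal, map_prod]
  simp only [map_zpow, mk_pointIdeal, map_zsmul, toMul_zsmul]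

theorem exists_eq_principalIdeal_iff [DecidableEq F] (P : Fin n → W.toAffine.Point)
    (x : Fin n → ℤ) :
    (∃ f, divisorIdeal P x = principalIdeal f) ↔ ∑ i, x i • P i = 0 := by
  rw [← mk_divisorIdeal_eq_one_iff, ← map_one (ClassGroup.mk W.toAffine.FunctionField), eq_comm,
    ClassGroup.mk_eq_mk]
  simp only [one_mul, eq_comm]

theorem divisorIdeal_mem_degreeGraph [DecidableEq F] (P : Fin n → W.toAffine.Point)
    (x : Fin n → ℤ) :
    (divisorIdeal P x, Multiplicative.ofAdd (∑ i, x i * affineDegree (P i))) ∈ degreeGraph W := by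
  have := (degreeGraph W).prod_mem (t := Finset.univ)
    (fun i _ => (degreeGraph W).zpow_mem (pointIdeal_mem_degreeGraph (P i)) (x i))
  convert this using 1
  refine Prod.ext ?_ ?_
  · simp [divisorIdeal, Prod.fst_prod]
  · rw [Prod.snd_prod, ofAdd_sum]
    change ∏ i, Multiplicative.ofAdd (x i * affineDegree (P i)) = _
    refine Finset.prod_congr rfl fun i _ => ?_
    exact ofAdd_zsmul (x i) (affineDegree (P i))

variable {m : MaximalSpectrum W.toAffine.CoordinateRing} {P : Fin n → W.toAffine.Point}

theorem divisorIdeal_mem_localGenerators_of_notMem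
    (hm : some m ∉ Set.range fun i => toClosedPoint W (P i)) (x : Fin n → ℤ) :
    (divisorIdeal P x, 1) ∈ localGenerators m := by
  have := (localGenerators m).prod_mem (t := Finset.univ)
    (fun i _ => (localGenerators m).zpow_mem
      (pointIdeal_mem_localGenerators (Q := P i) fun h => hm ⟨i, h⟩) (x i))
  convert this using 1
  refine Prod.ext ?_ ?_
  · simp [divisorIdeal, Prod.fst_prod]
  · simp [Prod.snd_prod]

theorem divisorIdeal_mem_localGenerators [DecidableEq F] (hP : Function.Injective P) {i : Fin n}
    (hi : toClosedPoint W (P i) = some m) {t : W.toAffine.FunctionFieldˣ}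
    (ht : (pointIdeal (P i), t) ∈ localGenerators m) (x : Fin n → ℤ) :
    (divisorIdeal P x, t ^ x i) ∈ localGenerators m := by
  have h : ∀ j, (pointIdeal (P j), if j = i then t else 1) ∈ localGenerators m := by
    intro j
    split_ifs with hj
    · rwa [hj]
    · exact pointIdeal_mem_localGenerators fun h =>
        hj (hP (toClosedPoint_injective (h.trans hi.symm)))
  have := (localGenerators m).prod_mem (t := Finset.univ)
    (fun j _ => (localGenerators m).zpow_mem (h j) (x j))
  convert this using 1
  refine Prod.ext ?_ ?_
  · simp [divisorIdeal, Prod.fst_prod]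
  · simp [Prod.snd_prod, ite_pow]

theorem sum_mul_affineDegree (hP : Function.Injective P) {i₀ : Fin n} (h₀ : P i₀ = 0)
    (x : Fin n → ℤ) : ∑ i, x i * affineDegree (P i) = ∑ i, x i - x i₀ := by
  have : ∀ i, x i * affineDegree (P i) = x i - if i = i₀ then x i else 0 := by
    intro i
    split_ifs with hi
    · rw [hi, h₀, affineDegree_zero]; simp
    · rw [affineDegree, if_neg fun h => hi (hP (h.trans h₀.symm))]; simp
  simp [this]

/-- Abel's theorem: a divisor supported on finitely many rational points, among them the point at
infinity, is principal if and only if its degree and its sum vanish. -/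
theorem mem_ellipticLattice_iff [DecidableEq F] (hP : Function.Injective P) {i₀ : Fin n}
    (h₀ : P i₀ = 0) (x : Fin n → ℤ) :
    x ∈ ellipticLattice W P ↔ ∑ i, x i = 0 ∧ ∑ i, x i • P i = 0 := by
  have hinf : toClosedPoint W (P i₀) = none := by rw [h₀]; rfl
  have hne : ∀ {i m}, toClosedPoint W (P i) = some m → i ≠ i₀ := by
    rintro i m h rfl
    simp [hinf] at h
  constructor
  · rintro ⟨f, hf, hunit, hord⟩
    -- Both ideals have the same local generators up to units: `t ^ x i` at the point `P i`, and 1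
    -- at closed points outside the support.
    have hJ : divisorIdeal P x = principalIdeal (Units.mk0 f hf) := by
      rw [← mul_inv_eq_one]
      refine eq_one_of_forall_mem_localGenerators fun m => ?_
      have hpr := toPrincipalIdeal_mem_localGenerators (m := m) (Units.mk0 f hf)
      by_cases hm : some m ∈ Set.range fun i => toClosedPoint W (P i)
      · obtain ⟨i, hi : toClosedPoint W (P i) = some m⟩ := hm
        obtain ⟨t, ht, ht'⟩ := exists_isUniformizerAt_pointIdeal hi
        have hfi := hord i
        rw [hi] at hfi
        obtain ⟨u, hu, e⟩ := hfi.exists_eq_zpow_mul ht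
        have hu' := (mem_localGenerators_iff_isUnitAt (m := m) (Units.mk0 u hu.1)).mpr hu
        have e' : Units.mk0 f hf = t ^ x i * Units.mk0 u hu.1 := Units.ext (by simpa using e)
        -- With `f = t ^ x i * u`, the product `(J, t ^ x i) ((f), f)⁻¹ (1, u)` equals `(J (f)⁻¹,
        -- 1)`.
        convert (localGenerators m).mul_mem ((localGenerators m).mul_mem
          (divisorIdeal_mem_localGenerators hP hi ht' x) ((localGenerators m).inv_mem hpr)) hu'
          using 1
        refine Prod.ext ?_ ?_
        · simp
        · simp [e']
      · have hu := (mem_localGenerators_iff_isUnitAt (m := m) (Units.mk0 f hf)).mpr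
          (hunit _ hm)
        convert (localGenerators m).mul_mem ((localGenerators m).mul_mem
          (divisorIdeal_mem_localGenerators_of_notMem hm x) ((localGenerators m).inv_mem hpr)) hu
          using 1
        refine Prod.ext ?_ ?_ <;> simp
    refine ⟨?_, (exists_eq_principalIdeal_iff P x).mp ⟨_, hJ⟩⟩
    have h1 := hord i₀
    rw [hinf] at h1
    have h2 := divisorIdeal_mem_degreeGraph P x
    rw [hJ, sum_mul_affineDegree hP h₀] at h2
    -- The order at infinity is `x i₀` by assumption and `-(∑ x i - x i₀)` by degree; equating them
    -- gives `∑ x i = 0`.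
    have h3 := h1.unique (hasOrd_infty_of_mem_degreeGraph h2) hf
    omega
  · rintro ⟨hx, hx'⟩
    obtain ⟨f, hf⟩ := (exists_eq_principalIdeal_iff P x).mpr hx'
    have hpr : ∀ m, (divisorIdeal P x, f) ∈ localGenerators m := fun m => by
      rw [hf]
      exact toPrincipalIdeal_mem_localGenerators f
    refine ⟨f, f.ne_zero, ?_, ?_⟩
    · rintro (_ | m) hc
      · exact absurd ⟨i₀, hinf⟩ hc
      · simpa using isUnitAt_div_of_mem_localGenerators (hpr m)
          (divisorIdeal_mem_localGenerators_of_notMem hc x)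
    · intro i
      cases hi : toClosedPoint W (P i) with
      | none =>
        obtain rfl : i = i₀ := hP (toClosedPoint_injective (hi.trans hinf.symm))
        have h2 := divisorIdeal_mem_degreeGraph P x
        rw [hf, sum_mul_affineDegree hP h₀, hx] at h2
        simpa using hasOrd_infty_of_mem_degreeGraph h2
      | some m =>
        obtain ⟨t, ht, ht'⟩ := exists_isUniformizerAt_pointIdeal hi
        have hu := isUnitAt_div_of_mem_localGenerators (hpr m)
          (divisorIdeal_mem_localGenerators hP hi ht' x)
        rw [Units.val_zpow_eq_zpow_val] at hu
        exact ⟨t, _, ht, hu, (mul_div_cancel₀ _ (zpow_ne_zero _ t.ne_zero)).symm⟩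

end Divisors

/-! ### Minimal vectors and the basis of the Barnes lattice -/

section BarnesLattice

variable {n : ℕ}

theorem stdVec_eq_single {m : ℕ} (hm : m < n) : stdVec n m = Pi.single ⟨m, hm⟩ 1 := by
  ext j
  simp [stdVec, Pi.single_apply, Fin.ext_iff]

theorem stdVec_dotProduct_stdVec {a b : ℕ} (ha : a < n) :
    stdVec n a ⬝ᵥ stdVec n b = if a = b then 1 else 0 := by
  rw [stdVec_eq_single ha, single_dotProduct]
  simp [stdVec]

theorem sum_stdVec {a : ℕ} (ha : a < n) : ∑ i, stdVec n a i = 1 := by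
  simp [stdVec_eq_single ha]

theorem sum_mul_stdVec {a : ℕ} (ha : a < n) : ∑ i : Fin n, (i : ℤ) * stdVec n a i = a := by
  simp [stdVec_eq_single ha, Pi.single_apply]

/-- One shape for all three kinds of `v_k`. Distinctness of the indices needs `n ≥ 5`: for `n = 4`
the indices 1 and `n - 3` of `v_{n-2}` coincide. -/
theorem exists_basisVec_eq (hn : 5 ≤ n) {k : ℕ} (hk : 1 ≤ k) (hkn : k ≤ n - 1) :
    ∃ a b c d : ℕ, (a < n ∧ b < n ∧ c < n ∧ d < n) ∧
      (a ≠ b ∧ a ≠ c ∧ a ≠ d ∧ b ≠ c ∧ b ≠ d ∧ c ≠ d) ∧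
      ((a : ℤ) + b = c + d ∨ (a : ℤ) + b = c + d - n) ∧
      basisVec n k = stdVec n a + stdVec n b - stdVec n c - stdVec n d := by
  unfold basisVec
  split_ifs with h1 h2
  · exact ⟨0, k, k + 1, n - 1, by omega, by omega, by omega, rfl⟩
  · exact ⟨1, n - 3, 0, n - 2, by omega, by omega, by omega, by abel⟩
  · exact ⟨1, n - 2, 0, n - 1, by omega, by omega, by omega, by abel⟩

theorem euclNorm_eq_sqrt (x : Fin n → ℤ) : euclNorm x = √((x ⬝ᵥ x : ℤ) : ℝ) := by
  rw [euclNorm, EuclideanSpace.norm_eq]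
  simp [dotProduct, pow_two]

theorem basisVec_dotProduct_self (hn : 5 ≤ n) {k : ℕ} (hk : 1 ≤ k) (hkn : k ≤ n - 1) :
    basisVec n k ⬝ᵥ basisVec n k = 4 := by
  obtain ⟨a, b, c, d, ⟨ha, hb, hc, hd⟩, ⟨h1, h2, h3, h4, h5, h6⟩, -, e⟩ :=
    exists_basisVec_eq hn hk hkn
  rw [e]
  simp only [add_dotProduct, sub_dotProduct, dotProduct_add, dotProduct_sub,
    stdVec_dotProduct_stdVec, ha, hb, hc, hd, h1, h2, h3, h4, h5, h6, h1.symm, h2.symm, h3.symm,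
    h4.symm, h5.symm, h6.symm, if_true, if_false]
  norm_num

theorem basisVec_mem_barnesLattice (hn : 5 ≤ n) {k : ℕ} (hk : 1 ≤ k) (hkn : k ≤ n - 1) :
    basisVec n k ∈ barnesLattice n := by
  obtain ⟨a, b, c, d, ⟨ha, hb, hc, hd⟩, -, hs, e⟩ := exists_basisVec_eq hn hk hkn
  rw [e]
  constructor
  · simp only [Pi.add_apply, Pi.sub_apply, Finset.sum_add_distrib, Finset.sum_sub_distrib,
      sum_stdVec, ha, hb, hc, hd]
    norm_num
  · simp only [Pi.add_apply, Pi.sub_apply, mul_add, mul_sub, Finset.sum_add_distrib,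
      Finset.sum_sub_distrib, sum_mul_stdVec, ha, hb, hc, hd]
    rw [Int.modEq_zero_iff_dvd]
    rcases hs with hs | hs
    · exact ⟨0, by linarith⟩
    · exact ⟨-1, by linarith⟩

/-- The Barnes lattice as a submodule of `ℤ^n`. -/
def barnesSubmodule (n : ℕ) : Submodule ℤ (Fin n → ℤ) where
  carrier := barnesLattice n
  add_mem' := by
    rintro x y ⟨hx, hx'⟩ ⟨hy, hy'⟩
    constructor
    · simp [Finset.sum_add_distrib, hx, hy]
    · simpa [Finset.sum_add_distrib, mul_add] using hx'.add hy'
  zero_mem' := ⟨by simp, by simp⟩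
  smul_mem' := by
    rintro c x ⟨hx, hx'⟩
    constructor
    · simp [← Finset.mul_sum, hx]
    · have h := hx'.mul_left c
      rw [mul_zero, Finset.mul_sum] at h
      simpa [mul_left_comm] using h

theorem even_dotProduct_self {x : Fin n → ℤ} (hx : ∑ i, x i = 0) : 2 ∣ x ⬝ᵥ x := by
  have h : x ⬝ᵥ x = ∑ i, (x i * x i - x i) := by
    rw [Finset.sum_sub_distrib, hx, sub_zero]; rfl
  rw [h]
  refine Finset.dvd_sum fun i _ => ?_
  have := Int.even_mul_pred_self (x i)
  rw [mul_sub, mul_one] at this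
  exact this.two_dvd

theorem exists_pos_of_sum_eq_zero {x : Fin n → ℤ} (hx : ∑ i, x i = 0) (h0 : x ≠ 0) :
    ∃ i, 0 < x i := by
  by_contra! h
  refine h0 (funext fun i => ?_)
  exact (Finset.sum_eq_zero_iff_of_nonpos fun i _ => h i).mp hx i (Finset.mem_univ i)

/-- The squared norm is even because `x_i² ≡ x_i` mod 2. If it were below 4, then with `x_p > 0 >
x_q` the vector `x - e_p + e_q` would have even squared norm at most 1, hence vanish. Then `x = e_p
- e_q` and `n ∣ p - q`, which is impossible for distinct `p, q < n`. -/
theorem four_le_dotProduct_self {x : Fin n → ℤ} (hx : x ∈ barnesLattice n) (h0 : x ≠ 0) :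
    4 ≤ x ⬝ᵥ x := by
  obtain ⟨hs, hm⟩ := hx
  obtain ⟨p, hp⟩ := exists_pos_of_sum_eq_zero hs h0
  obtain ⟨q, hq⟩ := exists_pos_of_sum_eq_zero (x := -x) (by simp [hs]) (neg_ne_zero.mpr h0)
  rw [Pi.neg_apply] at hq
  by_contra! hlt
  have hpq : p ≠ q := by rintro rfl; omega
  set z : Fin n → ℤ := x - Pi.single p 1 + Pi.single q 1 with hz
  have hzs : ∑ i, z i = 0 := by
    simp [hz, Finset.sum_add_distrib, Finset.sum_sub_distrib, hs]
  have hzz : z ⬝ᵥ z = x ⬝ᵥ x - 2 * x p + 2 * x q + 2 := by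
    simp only [hz, add_dotProduct, sub_dotProduct, dotProduct_add, dotProduct_sub,
      single_dotProduct, dotProduct_single, Pi.single_eq_same, Pi.single_eq_of_ne hpq,
      Pi.single_eq_of_ne hpq.symm, Pi.add_apply, Pi.sub_apply, mul_one, one_mul]
    ring
  have hz0 : z ⬝ᵥ z = 0 := by
    have h1 : 0 ≤ z ⬝ᵥ z := Finset.sum_nonneg fun i _ => mul_self_nonneg _
    have h2 := even_dotProduct_self hzs
    omega
  rw [dotProduct_self_eq_zero] at hz0
  have hxe : x = Pi.single p 1 - Pi.single q 1 := by
    rw [hz0] at hz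
    rw [← sub_eq_zero, hz]
    abel
  have hsum : ∑ i : Fin n, (i : ℤ) * x i = p - q := by
    simp [hxe, mul_sub, Finset.sum_sub_distrib, Pi.single_apply]
  rw [hsum, Int.modEq_zero_iff_dvd] at hm
  have h1 := p.isLt
  have h2 := q.isLt
  have h3 : (p : ℤ) - q = 0 := Int.eq_zero_of_abs_lt_dvd hm (by rw [abs_lt]; omega)
  exact hpq (Fin.ext (by omega))

theorem isMinimalVector_basisVec (hn : 5 ≤ n) {k : ℕ} (hk : 1 ≤ k) (hkn : k ≤ n - 1) :
    IsMinimalVector (barnesLattice n) (basisVec n k) := by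
  refine ⟨basisVec_mem_barnesLattice hn hk hkn, fun h => ?_, fun y hy h0 => ?_⟩
  · have := basisVec_dotProduct_self hn hk hkn
    simp [h] at this
  · rw [euclNorm_eq_sqrt, euclNorm_eq_sqrt, basisVec_dotProduct_self hn hk hkn]
    exact Real.sqrt_le_sqrt (by exact_mod_cast four_le_dotProduct_self hy h0)

theorem sum_smul_stdVec (x : Fin n → ℤ) : ∑ i : Fin n, x i • stdVec n i = x := by
  ext j
  simp [stdVec, Fin.ext_iff.symm]

/-- In `ℤ^n` modulo the span, with `d = e_0 - e_{n-1}`, the relations give `e_k = e_0 + k d` for all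
`k < n`, and `k = n - 1` yields `n d = 0`. So `x` maps to `(∑ x_i) e_0 + (∑ i x_i) d`, which is 0 on
the Barnes lattice. -/
theorem span_basisVec (hn : 5 ≤ n) :
    Submodule.span ℤ (Set.range fun i : Fin (n - 1) => basisVec n ((i : ℕ) + 1)) =
      barnesSubmodule n := by
  refine le_antisymm ?_ ?_
  · rw [Submodule.span_le]
    rintro _ ⟨i, rfl⟩
    exact basisVec_mem_barnesLattice hn (by omega) (by omega)
  set L := Submodule.span ℤ (Set.range fun i : Fin (n - 1) => basisVec n ((i : ℕ) + 1))
  have hv : ∀ k, 1 ≤ k → k ≤ n - 1 → L.mkQ (basisVec n k) = 0 := by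
    intro k hk hkn
    rw [Submodule.mkQ_apply, Submodule.Quotient.mk_eq_zero]
    exact Submodule.subset_span ⟨⟨k - 1, by omega⟩, by simp [Nat.sub_add_cancel hk]⟩
  set e : ℕ → (Fin n → ℤ) ⧸ L := fun k => L.mkQ (stdVec n k) with he
  set d := e 0 - e (n - 1) with hd
  have h1 : ∀ k, 1 ≤ k → k ≤ n - 3 → e (k + 1) = e k + d := by
    intro k hk hkn
    have := hv k hk (by omega)
    rw [basisVec, if_pos hkn, map_sub, map_sub, map_add] at this
    rw [hd, ← sub_eq_zero, ← neg_eq_zero, ← this]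
    simp only [he]
    abel
  have h2 : e (n - 2) = -e 0 + e 1 + e (n - 3) := by
    have := hv (n - 2) (by omega) (by omega)
    rw [basisVec, if_neg (by omega), if_pos rfl, map_sub, map_add, map_add, map_neg] at this
    exact (sub_eq_zero.mp this).symm
  have h3 : e (n - 1) = -e 0 + e 1 + e (n - 2) := by
    have := hv (n - 1) (by omega) (by omega)
    rw [basisVec, if_neg (by omega), if_neg (by omega), map_sub, map_add, map_add, map_neg] at this
    exact (sub_eq_zero.mp this).symm
  -- The vectors `v_{n-3}` and `v_{n-2}` both express `e_{n-2}` through `e_{n-3}`; comparing them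
  -- supplies the missing first step of the progression.
  have h4 : e 1 = e 0 + d := by
    have h := h1 (n - 3) (by omega) le_rfl
    rw [show n - 3 + 1 = n - 2 by omega, h2] at h
    have : e 1 = e 0 + (-e 0 + e 1 + e (n - 3)) - e (n - 3) := by abel
    rw [this, h]
    abel
  have h5 : ∀ k, k + 2 ≤ n → e k = e 0 + (k : ℤ) • d := by
    intro k
    induction k with
    | zero => simp
    | succ k ih =>
      intro hk
      rcases Nat.eq_zero_or_pos k with rfl | hk0
      · simpa using h4
      · rw [h1 k hk0 (by omega), ih (by omega), Nat.cast_succ, add_smul, one_smul, add_assoc]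
  have h6 : ∀ k, k < n → e k = e 0 + (k : ℤ) • d := by
    intro k hk
    rcases Nat.lt_or_ge (k + 1) n with hk' | hk'
    · exact h5 k hk'
    · obtain rfl : k = n - 1 := by omega
      rw [h3, h4, h5 (n - 2) (by omega), show ((n - 1 : ℕ) : ℤ) = ((n - 2 : ℕ) : ℤ) + 1 by omega,
        add_smul, one_smul]
      abel
  have h7 : (n : ℤ) • d = 0 := by
    have h := h6 (n - 1) (by omega)
    rw [show (n : ℤ) = ((n - 1 : ℕ) : ℤ) + 1 by omega, add_smul, one_smul]
    nth_rewrite 2 [hd]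
    rw [h]
    abel
  rintro x ⟨hx, hx'⟩
  rw [← Submodule.Quotient.mk_eq_zero, ← Submodule.mkQ_apply, ← sum_smul_stdVec x, map_sum]
  have h8 : ∀ i : Fin n, L.mkQ (x i • stdVec n i) = x i • e 0 + ((i : ℤ) * x i) • d := by
    intro i
    rw [map_smul, mul_comm, mul_smul, ← smul_add, ← h6 i i.isLt]
  obtain ⟨c, hc⟩ := Int.modEq_zero_iff_dvd.mp hx'
  rw [Finset.sum_congr rfl fun i _ => h8 i, Finset.sum_add_distrib, ← Finset.sum_smul,
    ← Finset.sum_smul, hx, hc, zero_smul, mul_comm, mul_smul, h7, smul_zero, add_zero]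

/-- Together with `e_0` the `v_k` are `n` vectors, so over `ℚ` it suffices that they span. They do,
since their integral span is the Barnes lattice, which contains every `n (e_j - e_0)`. -/
theorem linearIndependent_basisVec (hn : 5 ≤ n) :
    LinearIndependent ℤ (fun i : Fin (n - 1) => basisVec n ((i : ℕ) + 1)) := by
  let φ : (Fin n → ℤ) →ₗ[ℤ] (Fin n → ℚ) := (algebraMap ℤ ℚ).toIntAlgHom.toLinearMap.compLeft _
  have hφ : ∀ x i, φ x i = (x i : ℚ) := fun x i => rfl
  let z : Fin n := ⟨0, by omega⟩
  let w : Option (Fin (n - 1)) → Fin n → ℚ := fun o =>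
    o.elim (Pi.single z 1) fun i => φ (basisVec n ((i : ℕ) + 1))
  have hw : LinearIndependent ℚ w := by
    refine linearIndependent_of_top_le_span_of_card_eq_finrank ?_ (by simp; omega)
    have hz : Pi.single z (1 : ℚ) ∈ Submodule.span ℚ (Set.range w) :=
      Submodule.subset_span ⟨none, rfl⟩
    have hB : ∀ x ∈ barnesSubmodule n, φ x ∈ Submodule.span ℚ (Set.range w) := by
      intro x hx
      rw [← span_basisVec hn] at hx
      induction hx using Submodule.span_induction with
      | mem x hx =>
        obtain ⟨i, rfl⟩ := hx
        exact Submodule.subset_span ⟨some i, rfl⟩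
      | zero => simp
      | add x y _ _ hx hy => rw [map_add]; exact Submodule.add_mem _ hx hy
      | smul c x _ hx => rw [map_smul]; exact zsmul_mem hx c
    have hj : ∀ j : Fin n, Pi.single j (1 : ℚ) ∈ Submodule.span ℚ (Set.range w) := by
      intro j
      have h := hB ((n : ℤ) • (Pi.single j 1 - Pi.single z 1)) ⟨by simp [← Finset.mul_sum], by
        rw [Int.modEq_zero_iff_dvd]
        refine Finset.dvd_sum fun i _ => ?_
        rw [Pi.smul_apply, smul_eq_mul]
        exact (dvd_mul_right _ _).mul_left _⟩
      have e : φ ((n : ℤ) • (Pi.single j 1 - Pi.single z 1)) =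
          (n : ℚ) • (Pi.single j 1 - Pi.single z 1) := by
        ext i
        simp [hφ, Pi.single_apply]
      have hn0 : (n : ℚ) ≠ 0 := by positivity
      rw [e, Submodule.smul_mem_iff _ hn0] at h
      simpa using Submodule.add_mem _ h hz
    intro x _
    rw [← Finset.univ_sum_single x]
    refine Submodule.sum_mem _ fun j _ => ?_
    have : Pi.single j (x j) = x j • Pi.single (M := fun _ => ℚ) j 1 := by
      rw [← Pi.single_smul, smul_eq_mul, mul_one]
    rw [this]
    exact Submodule.smul_mem _ _ (hj j)
  have h1 : LinearIndependent ℚ fun i : Fin (n - 1) => φ (basisVec n ((i : ℕ) + 1)) :=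
    hw.comp some (Option.some_injective _)
  exact LinearIndependent.of_comp φ (h1.restrict_scalars' ℤ)

end BarnesLattice
-- Specialization to the multiples of a generator
theorem ellipticLattice_nsmul_eq_barnesLattice {F : Type*} [Field F] [DecidableEq F]
    (W : WeierstrassCurve F) {n : ℕ} (hn : 0 < n) (P : W.toAffine.Point)
    (hP : addOrderOf P = n) :
    ellipticLattice W (fun i : Fin n => (i : ℕ) • P) = barnesLattice n := by
  have hinj : Function.Injective fun i : Fin n => (i : ℕ) • P := fun i j h =>
    Fin.ext (nsmul_injOn_Iio_addOrderOf (by simp [hP]) (by simp [hP]) h)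
  ext x
  rw [mem_ellipticLattice_iff hinj (i₀ := ⟨0, hn⟩) (zero_nsmul P)]
  have h : ∑ i : Fin n, x i • (i : ℕ) • P = (∑ i : Fin n, (i : ℤ) * x i) • P := by
    rw [Finset.sum_smul]
    refine Finset.sum_congr rfl fun i _ => ?_
    rw [mul_comm, mul_smul, natCast_zsmul]
  -- The sum of the divisor is `(∑ i x_i) P`, which vanishes exactly when the order `n` divides the
  -- coefficient.
  rw [h, ← addOrderOf_dvd_iff_zsmul_eq_zero, hP, ← Int.modEq_zero_iff_dvd]
  rfl

theorem theorem3p2 {F : Type*} [Field F] [Finite F] [DecidableEq F]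
    (W : WeierstrassCurve F) [W.IsElliptic]
    (G : AddSubgroup W.toAffine.Point) (n : ℕ) (hn : 5 ≤ n) (hG : Nat.card G = n)
    (P : W.toAffine.Point) (hP : AddSubgroup.zmultiples P = G) :
    ellipticLattice W (fun i : Fin n => (i : ℕ) • P) = barnesLattice n ∧
    (∀ i : Fin (n - 1), IsMinimalVector
      (ellipticLattice W (fun i : Fin n => (i : ℕ) • P)) (basisVec n ((i : ℕ) + 1))) ∧
    LinearIndependent ℤ (fun i : Fin (n - 1) => basisVec n ((i : ℕ) + 1)) ∧
    (Submodule.span ℤ (Set.range fun i : Fin (n - 1) => basisVec n ((i : ℕ) + 1)) :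
      Set (Fin n → ℤ)) = ellipticLattice W (fun i : Fin n => (i : ℕ) • P) := by
  have hord : addOrderOf P = n := by rw [← hG, ← hP, Nat.card_zmultiples]
  rw [ellipticLattice_nsmul_eq_barnesLattice W (by omega) P hord]
  exact ⟨rfl, fun i => isMinimalVector_basisVec hn (by omega) (by omega),
    linearIndependent_basisVec hn, congrArg SetLike.coe (span_basisVec hn)⟩
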